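/- **Setting.** Let $\mathcal H$ be a real reproducing kernel Hilbert space of functions on a set $\mathcal X$ with kernel $K(\cdot,\cdot)$, let $x_1,\dots,x_n\in\mathcal X$, $f^*\in\mathcal H$ and $y_i=f^*(x_i)$. Let $K=(K(x_i,x_j))_{i,j}$ be the Gram matrix, with columns $K_1,\dots,K_n$, diagonal entries $\lambda_i=K(x_i,x_i)$ and eigenvalues $\gamma_1\ge\dots\ge\gamma_n$. Assume that $K$ is positive definite, and put $\hat\alpha=K^{-1}y$. For $\alpha\in\mathbb R^n$ put $f_\alpha=\sum_i\alpha_iK(x_i,\cdot)$ and $b=\alpha-\hat\alpha$, and let $\mathcal H_s=\{f_\alpha:\alpha\in\mathbb R^n\}$. The estimation error of $f$ is $\Delta(f)=\|f-f^*\|_{\mathcal H}^2-\inf_{g\in\mathcal H_s}\|g-f^*\|_{\mathcal H}^2$, and $\Delta_a^*=\inf\{\Delta(f_\alpha):\frac1{2n}\|K\alpha-y\|_2^2=a\}$. **(0)** For $n\ge1$, $\Delta(f_\alpha)=b^TKb$ for every $\alpha$, and for every $a\ge0$ one has $\Delta_a^*=2na/\gamma_1$, and the infimum is attained. In (1) and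 (2) assume $\lambda_1\ge\dots\ge\lambda_n>0$ and $|K_{i,j}|\le\tau$ for $i\ne j$, with some $\tau\ge0$. The algorithms start at a deterministic $\alpha_0$; write $b_k=\alpha_k-\hat\alpha$. **(1) SGD.** Let $\alpha_{t+1}=\alpha_t-\eta_t(K_{i_t}^T\alpha_t-y_{i_t})K_{i_t}$ with $i_t$ independent and uniform on $\{1,\dots,n\}$, with step size $\eta_1$ in steps $1,\dots,k_1$ and $\eta_2$ in steps $k_1+1,\dots,k_2$. For all $c_1,c_2>0$ there are $C_1,C_2,C_3>0$ such that for all $g,\beta_0,R>0$ there is a polynomial $p$, positive on $(0,\infty)$, such that for every $n\ge2$ there is a $D$ with the following property. Suppose that $\lambda_n-n\tau\ge c_1$, $\lambda_1+n\tau\le c_2$, $\lambda_1^2-\lambda_2^2\ge g$, $\|b_0\|_2\le R$ and $\|P_1b_0\|_2\ge\beta_0$, where $P_1$ is the orthogonal projection onto the complement of $\mathrm{span}(K_2,\dots,K_n)$, and that $$\frac{2}{\lambda_1^2-C_1\sqrt n\,\tau}<\eta_1<\frac{2}{\lambda_2^2+C_2\sqrt n\,\tau},\qquad 0<\eta_2<\frac{1}{\lambda_1^2+C_3\sqrt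 n\,\tau},\qquad 0<\epsilon<\tfrac14,\qquad n\tau<p(\epsilon).$$ Then there are $1\le k_1\le D\log\frac1\epsilon$ and $k_2>k_1$ such that the SGD output $\alpha_{k_2}$ satisfies $(1-2\epsilon)\gamma_1\le E\|Kb_{k_2}\|_2/E\|b_{k_2}\|_2\le\gamma_1$ and $$E[\Delta^{1/2}(f_{\alpha_{k_2}})]\le(1+4\epsilon)(\Delta_a^*)^{1/2},\qquad\text{where } (E\|K\alpha_{k_2}-y\|_2)^2=2na.$$ **(2) GD.** Let $n\ge1$, $\alpha_{t+1}=\alpha_t-\frac\eta nK^T(K\alpha_t-y)$ with $0<\eta<n/(\lambda_1+n\tau)^2$, and suppose that $b_0$ is not orthogonal to the eigenspace of $K$ for the eigenvalue $\gamma_n$. Then there is a $D$ such that for every $\epsilon'$ with $0<\epsilon'<1-\gamma_n/\gamma_1$ and every $k\ge D\log\frac1{\epsilon'}$, the GD output $\alpha_k$ satisfies $\gamma_n\le\|Kb_k\|_2/\|b_k\|_2\le\sqrt{1+\epsilon'}\,\gamma_n$ and $$\Delta(f_{\alpha_k})\ge M\Delta_a^*,\qquad M=\frac{\gamma_1}{\gamma_n}(1-\epsilon')>1,\qquad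 a=\tfrac1{2n}\|K\alpha_k-y\|_2^2.$$ -/

import Mathlib

/- Throughout, `H` is a real reproducing kernel Hilbert space of functions on `X`,
`x : Fin n → X` are the data points and `fstar : H` is the ground truth, so the labels are
`y i = fstar (x i)`. Indices `1, …, n` of the mathematics are `0, …, n - 1` here. -/

noncomputable section

namespace KernelSGD

variable {n : ℕ}

/-- Euclidean norm of a coordinate vector. -/
def l2norm (v : Fin n → ℝ) : ℝ := ‖WithLp.toLp 2 v‖

section RKHSSetting

variable {X : Type*} (H : Type*) [NormedAddCommGroup H] [InnerProductSpace ℝ H]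
  [CompleteSpace H] [RKHS ℝ H X ℝ]

/-- The Gram matrix `K i j = K(x i, x j)`. -/
def gram (x : Fin n → X) : Matrix (Fin n) (Fin n) ℝ :=
  Matrix.of fun i j => RKHS.kernel H (x i) (x j) (1 : ℝ)

theorem gram_eq_inner (x : Fin n → X) (i j : Fin n) :
    gram H x i j = inner ℝ (RKHS.kerFun H (x j) (1 : ℝ)) (RKHS.kerFun H (x i) (1 : ℝ)) := by
  rw [← RKHS.kernel_inner]
  simp [gram]

theorem gram_isHermitian (x : Fin n → X) : (gram H x).IsHermitian := by
  ext i j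
  simp only [Matrix.conjTranspose_apply, star_trivial, gram_eq_inner]
  exact real_inner_comm _ _

/-- The eigenvalues of the Gram matrix in non-increasing order, with multiplicity. -/
def gramEig (x : Fin n → X) (j : Fin n) : ℝ :=
  (gram_isHermitian H x).eigenvalues₀ (Fin.cast (Fintype.card_fin n).symm j)

/-- The element `∑ i, α i • K(·, x i)` of `H`. -/
def estimator (x : Fin n → X) (α : Fin n → ℝ) : H :=
  ∑ i, α i • RKHS.kerFun H (x i) (1 : ℝ)

/-- The hypothesis class of all `∑ i, α i • K(·, x i)`. -/
def hypothesisClass (x : Fin n → X) : Set H := Set.range (estimator H x)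

variable {H}

/-- The labels `y i = fstar (x i)`. -/
def labels (x : Fin n → X) (fstar : H) : Fin n → ℝ := fun i => fstar (x i)

/-- The minimizer `K⁻¹ y` of the empirical risk (for invertible `K`). -/
def alphaHat (x : Fin n → X) (fstar : H) : Fin n → ℝ :=
  (gram H x)⁻¹.mulVec (labels x fstar)

/-- The generalization error `‖f - fstar‖ ^ 2`, in the norm of `H`. -/
def genError (fstar f : H) : ℝ := ‖f - fstar‖ ^ 2

/-- The estimation error: the excess of the generalization error of `f` over its infimum on the
hypothesis class. -/
def estimationError (x : Fin n → X) (fstar f : H) : ℝ :=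
  genError fstar f - sInf (genError fstar '' hypothesisClass H x)

/-- The residual `K α - y`. -/
def residual (x : Fin n → X) (fstar : H) (α : Fin n → ℝ) : Fin n → ℝ :=
  (gram H x).mulVec α - labels x fstar

/-- The training loss `‖K α - y‖ ^ 2 / (2 n)`. -/
def trainingLoss (x : Fin n → X) (fstar : H) (α : Fin n → ℝ) : ℝ :=
  1 / (2 * (n : ℝ)) * l2norm (residual x fstar α) ^ 2

/-- The `a`-level set of the training loss in the hypothesis class. -/
def levelSet (x : Fin n → X) (fstar : H) (a : ℝ) : Set H :=
  {f | ∃ α : Fin n → ℝ, f = estimator H x α ∧ trainingLoss x fstar α = a}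

/-- The best estimation error on the `a`-level set. -/
def bestError (x : Fin n → X) (fstar : H) (a : ℝ) : ℝ :=
  sInf (estimationError x fstar '' levelSet x fstar a)

end RKHSSetting

/-- The diagonal of `K` is positive and non-increasing, and its off-diagonal entries are at most
`τ` in absolute value. -/
structure HasSmallOffDiag (K : Matrix (Fin n) (Fin n) ℝ) (τ : ℝ) : Prop where
  tau_nonneg : 0 ≤ τ
  diag_pos : ∀ i, 0 < K i i
  diag_antitone : Antitone fun i => K i i
  off_diag : ∀ i j, i ≠ j → |K i j| ≤ τ

/-- `P₁ v`: the projection of `v` onto the orthogonal complement of the span of all columns of `K`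
other than the first one. -/
def projFirst (K : Matrix (Fin n) (Fin n) ℝ) (v : Fin n → ℝ) : EuclideanSpace ℝ (Fin n) :=
  (Submodule.span ℝ {c : EuclideanSpace ℝ (Fin n) |
    ∃ j : Fin n, (j : ℕ) ≠ 0 ∧ c = WithLp.toLp 2 (K.col j)})ᗮ.starProjection (WithLp.toLp 2 v)

/-- One SGD step with sampled index `i`: `α - η (Kᵢᵀ α - yᵢ) Kᵢ`. -/
def sgdStep (K : Matrix (Fin n) (Fin n) ℝ) (y : Fin n → ℝ) (η : ℝ) (i : Fin n)
    (α : Fin n → ℝ) : Fin n → ℝ :=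
  α - (η * (K.col i ⬝ᵥ α - y i)) • K.col i

/-- The SGD iterate after `k` steps along the sampled indices `s 0, …, s (k - 1)`;
step number `t + 1` has step size `η t`. -/
def sgdIterate (K : Matrix (Fin n) (Fin n) ℝ) (y : Fin n → ℝ) (η : ℕ → ℝ) (α₀ : Fin n → ℝ) :
    (k : ℕ) → (Fin k → Fin n) → Fin n → ℝ
  | 0, _ => α₀
  | k + 1, s => sgdStep K y (η k) (s (Fin.last k)) (sgdIterate K y η α₀ k (Fin.init s))

/-- The expectation of `F` of the `k`-th SGD iterate, where the indices are independent and uniform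
on `Fin n`, so that every index sequence of length `k` has probability `1 / n ^ k`. -/
def sgdExpect (K : Matrix (Fin n) (Fin n) ℝ) (y : Fin n → ℝ) (η : ℕ → ℝ) (α₀ : Fin n → ℝ)
    (k : ℕ) (F : (Fin n → ℝ) → ℝ) : ℝ :=
  (∑ s : Fin k → Fin n, F (sgdIterate K y η α₀ k s)) / (n : ℝ) ^ k

/-- Step sizes of the two-stage scheme: `η₁` in steps `1, …, k₁`, and `η₂` afterwards. -/
def twoStage (η₁ η₂ : ℝ) (k₁ : ℕ) (t : ℕ) : ℝ := if t < k₁ then η₁ else η₂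

/-- The GD iterate after `k` steps `α - (η / n) Kᵀ (K α - y)`. -/
def gdIterate (K : Matrix (Fin n) (Fin n) ℝ) (y : Fin n → ℝ) (η : ℝ) (α₀ : Fin n → ℝ) :
    ℕ → Fin n → ℝ
  | 0 => α₀
  | k + 1 => gdIterate K y η α₀ k -
      (η / n) • K.transpose.mulVec (K.mulVec (gdIterate K y η α₀ k) - y)

end KernelSGD

end

universe u v

open KernelSGD

/-! Write b = α - K⁻¹y. The interpolant differs from f* by an element orthogonal to the hypothesis
class, so Pythagoras gives bᵀKb as estimation error, while the training loss is ‖Kb‖²/(2n). Since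
‖Kb‖² ≤ γ₁ bᵀKb, with equality for top eigenvectors, the best b at a fixed loss is a top eigenvector
and a bottom eigenvector is worse by the factor γ₁/γₙ. Both algorithms are therefore judged by the
direction in which b ends up.

GD multiplies the eigencoordinates of b by 1 - (η/n)λ², with λ the eigenvalue. These factors lie in
(0,1) and are largest at γₙ, so the bottom eigenspace dominates at a geometric rate
(`exists_log_gdIterate`).

An SGD step is the rank-one update b - η⟨Kᵢ,b⟩Kᵢ. The unit vector u along K⁻¹e₁ is orthogonal to
every column but the first, so ⟨u,b⟩ changes only when the first index is drawn. The bounds on η₁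
make that change expanding, up to cross terms, while the other columns contract the part of b
orthogonal to u. The cross terms have order √n τ (`exists_isNearlyAligned`). Averaging gives a
linear recursion for A = E|⟨u,b⟩| and B = E‖b - ⟨u,b⟩u‖, along which B/A falls geometrically to
order ε (`ratio_le_of_recursion`). One step of the second stage costs only a constant factor
(`sgdExpect_perp_le`). As u is almost a top eigenvector, E‖Kb‖ is then close to γ₁E‖b‖, and √(bᵀKb)
≤ √γ₁ ‖b‖ finishes the estimate (`estimationError_of_perp_le`). -/

noncomputable section

namespace KernelSGD

variable {n : ℕ}

open Matrix

/-! ### Quadratic forms and norms in an orthonormal eigenbasis. -/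

section Spectral

variable {K : Matrix (Fin n) (Fin n) ℝ}

/-- The coordinates of a vector in an orthonormal eigenbasis of a symmetric matrix. -/
def coord (hK : K.IsHermitian) (v : Fin n → ℝ) (i : Fin n) : ℝ :=
  inner ℝ (hK.eigenvectorBasis i) (WithLp.toLp 2 v)

theorem inner_toLp (v w : Fin n → ℝ) :
    inner ℝ (WithLp.toLp 2 v) (WithLp.toLp 2 w) = v ⬝ᵥ w := by
  rw [EuclideanSpace.inner_eq_star_dotProduct]
  simp [dotProduct_comm]

theorem l2norm_nonneg (v : Fin n → ℝ) : 0 ≤ l2norm v := norm_nonneg _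

theorem l2norm_sq (v : Fin n → ℝ) : l2norm v ^ 2 = v ⬝ᵥ v := by
  rw [l2norm, ← inner_toLp, real_inner_self_eq_norm_sq]

theorem coord_sub (hK : K.IsHermitian) (v w : Fin n → ℝ) (i : Fin n) :
    coord hK (v - w) i = coord hK v i - coord hK w i := by
  simp [coord, inner_sub_right]

theorem coord_smul (hK : K.IsHermitian) (c : ℝ) (v : Fin n → ℝ) (i : Fin n) :
    coord hK (c • v) i = c * coord hK v i := by
  simp [coord, inner_smul_right]

theorem dotProduct_eq_sum_coord (hK : K.IsHermitian) (v w : Fin n → ℝ) :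
    v ⬝ᵥ w = ∑ i, coord hK v i * coord hK w i := by
  rw [← inner_toLp, ← hK.eigenvectorBasis.sum_inner_mul_inner]
  exact Finset.sum_congr rfl fun i _ => by rw [coord, coord, real_inner_comm]

theorem l2norm_sq_eq_sum_coord (hK : K.IsHermitian) (v : Fin n → ℝ) :
    l2norm v ^ 2 = ∑ i, coord hK v i ^ 2 := by
  rw [l2norm_sq, dotProduct_eq_sum_coord hK]
  exact Finset.sum_congr rfl fun i _ => (sq _).symm

theorem dotProduct_mulVec_comm (hK : K.IsHermitian) (v w : Fin n → ℝ) :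
    v ⬝ᵥ K.mulVec w = K.mulVec v ⬝ᵥ w := by
  have : Kᵀ = K := by rw [← conjTranspose_eq_transpose_of_trivial]; exact hK
  rw [dotProduct_mulVec, ← mulVec_transpose, this]

theorem coord_mulVec (hK : K.IsHermitian) (v : Fin n → ℝ) (i : Fin n) :
    coord hK (K.mulVec v) i = hK.eigenvalues i * coord hK v i := by
  have h := hK.mulVec_eigenvectorBasis i
  have e : ∀ w : Fin n → ℝ, coord hK w i = (hK.eigenvectorBasis i).ofLp ⬝ᵥ w := fun w => by
    rw [← inner_toLp]; rfl
  rw [e, e, dotProduct_mulVec_comm hK, h, smul_dotProduct, smul_eq_mul]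

theorem l2norm_eigenvectorBasis (hK : K.IsHermitian) (i : Fin n) :
    l2norm (hK.eigenvectorBasis i).ofLp = 1 :=
  hK.eigenvectorBasis.orthonormal.1 i

theorem l2norm_smul (c : ℝ) (v : Fin n → ℝ) : l2norm (c • v) = |c| * l2norm v := by
  rw [l2norm, WithLp.toLp_smul, norm_smul, Real.norm_eq_abs, l2norm]

theorem quadForm_eq_sum (hK : K.IsHermitian) (v : Fin n → ℝ) :
    v ⬝ᵥ K.mulVec v = ∑ i, hK.eigenvalues i * coord hK v i ^ 2 := by
  rw [dotProduct_eq_sum_coord hK]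
  exact Finset.sum_congr rfl fun i _ => by rw [coord_mulVec]; ring

theorem l2norm_mulVec_sq_eq_sum (hK : K.IsHermitian) (v : Fin n → ℝ) :
    l2norm (K.mulVec v) ^ 2 = ∑ i, hK.eigenvalues i ^ 2 * coord hK v i ^ 2 := by
  rw [l2norm_sq_eq_sum_coord hK]
  exact Finset.sum_congr rfl fun i _ => by rw [coord_mulVec]; ring

theorem quadForm_le (hK : K.IsHermitian) {γ : ℝ} (h : ∀ i, hK.eigenvalues i ≤ γ)
    (v : Fin n → ℝ) : v ⬝ᵥ K.mulVec v ≤ γ * l2norm v ^ 2 := by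
  rw [quadForm_eq_sum hK, l2norm_sq_eq_sum_coord hK, Finset.mul_sum]
  exact Finset.sum_le_sum fun i _ => mul_le_mul_of_nonneg_right (h i) (sq_nonneg _)

theorem le_quadForm (hK : K.IsHermitian) {γ : ℝ} (h : ∀ i, γ ≤ hK.eigenvalues i)
    (v : Fin n → ℝ) : γ * l2norm v ^ 2 ≤ v ⬝ᵥ K.mulVec v := by
  rw [quadForm_eq_sum hK, l2norm_sq_eq_sum_coord hK, Finset.mul_sum]
  exact Finset.sum_le_sum fun i _ => mul_le_mul_of_nonneg_right (h i) (sq_nonneg _)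

/-- Eigenvalue by eigenvalue this is λ² ≤ γλ. It bounds the estimation error from below at a given
training loss. -/
theorem l2norm_mulVec_sq_le (hK : K.IsHermitian) {γ : ℝ} (h0 : ∀ i, 0 ≤ hK.eigenvalues i)
    (h : ∀ i, hK.eigenvalues i ≤ γ) (v : Fin n → ℝ) :
    l2norm (K.mulVec v) ^ 2 ≤ γ * (v ⬝ᵥ K.mulVec v) := by
  rw [quadForm_eq_sum hK, l2norm_mulVec_sq_eq_sum hK, Finset.mul_sum]
  refine Finset.sum_le_sum fun i _ => ?_
  rw [← mul_assoc, sq (hK.eigenvalues i)]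
  exact mul_le_mul_of_nonneg_right (mul_le_mul_of_nonneg_right (h i) (h0 i)) (sq_nonneg _)

theorem l2norm_mulVec_le (hK : K.IsHermitian) {γ : ℝ} (hγ : 0 ≤ γ)
    (h0 : ∀ i, 0 ≤ hK.eigenvalues i) (h : ∀ i, hK.eigenvalues i ≤ γ) (v : Fin n → ℝ) :
    l2norm (K.mulVec v) ≤ γ * l2norm v := by
  refine (sq_le_sq₀ (l2norm_nonneg _) (mul_nonneg hγ (l2norm_nonneg v))).1 ?_
  refine (l2norm_mulVec_sq_le hK h0 h v).trans ?_
  rw [mul_pow, sq γ, mul_assoc]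
  exact mul_le_mul_of_nonneg_left (quadForm_le hK h v) hγ

theorem le_l2norm_mulVec (hK : K.IsHermitian) {γ : ℝ} (hγ : 0 ≤ γ)
    (h : ∀ i, γ ≤ hK.eigenvalues i) (v : Fin n → ℝ) :
    γ * l2norm v ≤ l2norm (K.mulVec v) := by
  refine (sq_le_sq₀ (mul_nonneg hγ (l2norm_nonneg v)) (l2norm_nonneg _)).1 ?_
  rw [mul_pow, l2norm_mulVec_sq_eq_sum hK, l2norm_sq_eq_sum_coord hK, Finset.mul_sum]
  exact Finset.sum_le_sum fun i _ =>
    mul_le_mul_of_nonneg_right (pow_le_pow_left₀ hγ (h i) 2) (sq_nonneg _)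

/-- Every sorted eigenvalue is one of the eigenvalues indexed by the rows. -/
theorem exists_eigenvalues_eq (hK : K.IsHermitian) (j : Fin n) :
    ∃ i, hK.eigenvalues i = hK.eigenvalues₀ (Fin.cast (Fintype.card_fin n).symm j) := by
  refine ⟨Fintype.equivOfCardEq (Fintype.card_fin _) (Fin.cast (Fintype.card_fin n).symm j), ?_⟩
  rw [IsHermitian.eigenvalues, Equiv.symm_apply_apply]

theorem eigenvalues_le_first (hK : K.IsHermitian) (h : 0 < n) (i : Fin n) :
    hK.eigenvalues i ≤ hK.eigenvalues₀ (Fin.cast (Fintype.card_fin n).symm ⟨0, h⟩) :=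
  hK.eigenvalues₀_antitone (by rw [Fin.le_def]; simp)

theorem last_le_eigenvalues (hK : K.IsHermitian) (h : n - 1 < n) (i : Fin n) :
    hK.eigenvalues₀ (Fin.cast (Fintype.card_fin n).symm ⟨n - 1, h⟩) ≤ hK.eigenvalues i := by
  refine hK.eigenvalues₀_antitone ?_
  rw [Fin.le_def]
  have := ((Fintype.equivOfCardEq (Fintype.card_fin (Fintype.card (Fin n)))).symm i).isLt
  simp only [Fintype.card_fin] at this
  simp only [Fin.val_cast]
  omega

end Spectral

/-! ### The estimation error as a quadratic form, and its minimum on a level set. -/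

section EstimationError

variable {X : Type*} {H : Type*} [NormedAddCommGroup H] [InnerProductSpace ℝ H]
  [CompleteSpace H] [RKHS ℝ H X ℝ]

theorem estimator_sub (x : Fin n → X) (α β : Fin n → ℝ) :
    estimator H x (α - β) = estimator H x α - estimator H x β := by
  simp [estimator, sub_smul]

theorem inner_estimator (x : Fin n → X) (α : Fin n → ℝ) (f : H) :
    inner ℝ (estimator H x α) f = α ⬝ᵥ labels x f := by
  simp only [estimator, sum_inner, inner_smul_left, RKHS.kerFun_inner, dotProduct, labels]
  simp

theorem labels_estimator (x : Fin n → X) (α : Fin n → ℝ) :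
    labels x (estimator H x α) = (gram H x).mulVec α := by
  funext i
  have h : estimator H x α (x i) = inner ℝ (estimator H x α) (RKHS.kerFun H (x i) (1 : ℝ)) := by
    rw [RKHS.inner_kerFun]; simp
  rw [labels, h, estimator, sum_inner]
  simp only [inner_smul_left, mulVec, dotProduct, gram_eq_inner]
  exact Finset.sum_congr rfl fun j _ => by simp [mul_comm]

omit [CompleteSpace H] in
theorem labels_sub (x : Fin n → X) (f g : H) : labels x (f - g) = labels x f - labels x g := by
  funext i; simp [labels]

theorem gram_mulVec_alphaHat (x : Fin n → X) (fstar : H) (hK : (gram H x).PosDef) :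
    (gram H x).mulVec (alphaHat x fstar) = labels x fstar := by
  rw [alphaHat, mulVec_mulVec, mul_nonsing_inv _ hK.det_pos.ne'.isUnit, one_mulVec]

theorem residual_eq_mulVec (x : Fin n → X) (fstar : H) (hK : (gram H x).PosDef)
    (α : Fin n → ℝ) : residual x fstar α = (gram H x).mulVec (α - alphaHat x fstar) := by
  rw [residual, mulVec_sub, gram_mulVec_alphaHat x fstar hK]

/-- Pythagoras: `fstar` differs from its interpolant by an element orthogonal to the class. -/
theorem genError_estimator (x : Fin n → X) (fstar : H) (hK : (gram H x).PosDef)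
    (α : Fin n → ℝ) :
    genError fstar (estimator H x α) =
      (α - alphaHat x fstar) ⬝ᵥ (gram H x).mulVec (α - alphaHat x fstar) +
        genError fstar (estimator H x (alphaHat x fstar)) := by
  have h : estimator H x α - fstar = estimator H x (α - alphaHat x fstar) +
      (estimator H x (alphaHat x fstar) - fstar) := by rw [estimator_sub]; abel
  have horth : inner ℝ (estimator H x (α - alphaHat x fstar))
      (estimator H x (alphaHat x fstar) - fstar) = 0 := by
    rw [inner_estimator, labels_sub, labels_estimator, gram_mulVec_alphaHat x fstar hK, sub_self,
      dotProduct_zero]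
  rw [genError, genError, h, norm_add_sq_real, horth, ← real_inner_self_eq_norm_sq,
    inner_estimator, labels_estimator]
  ring

theorem estimationError_estimator (x : Fin n → X) (fstar : H) (hK : (gram H x).PosDef)
    (α : Fin n → ℝ) :
    estimationError x fstar (estimator H x α) =
      (α - alphaHat x fstar) ⬝ᵥ (gram H x).mulVec (α - alphaHat x fstar) := by
  have hleast : IsLeast (genError fstar '' hypothesisClass H x)
      (genError fstar (estimator H x (alphaHat x fstar))) := by
    refine ⟨⟨_, ⟨_, rfl⟩, rfl⟩, ?_⟩
    rintro _ ⟨_, ⟨β, rfl⟩, rfl⟩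
    rw [genError_estimator x fstar hK β]
    have := hK.posSemidef.dotProduct_mulVec_nonneg (β - alphaHat x fstar)
    simp only [star_trivial] at this
    linarith
  rw [estimationError, hleast.csInf_eq, genError_estimator x fstar hK α]
  ring

theorem gramEig_eq (x : Fin n → X) (j : Fin n) :
    ∃ i, (gram_isHermitian H x).eigenvalues i = gramEig H x j :=
  exists_eigenvalues_eq _ j

theorem eigenvalues_le_gramEig (x : Fin n → X) (h : 0 < n) (i : Fin n) :
    (gram_isHermitian H x).eigenvalues i ≤ gramEig H x ⟨0, h⟩ :=
  eigenvalues_le_first _ h i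

theorem gramEig_le_eigenvalues (x : Fin n → X) (h : n - 1 < n) (i : Fin n) :
    gramEig H x ⟨n - 1, h⟩ ≤ (gram_isHermitian H x).eigenvalues i :=
  last_le_eigenvalues _ h i

theorem gramEig_pos (x : Fin n → X) (hK : (gram H x).PosDef) (j : Fin n) :
    0 < gramEig H x j := by
  obtain ⟨i, hi⟩ := gramEig_eq (H := H) x j
  rw [← hi]
  exact hK.eigenvalues_pos i

theorem isLeast_estimationError (x : Fin n → X) (fstar : H) (hK : (gram H x).PosDef)
    (hn : 0 < n) {a : ℝ} (ha : 0 ≤ a) :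
    IsLeast (estimationError x fstar '' levelSet x fstar a)
      (2 * n * a / gramEig H x ⟨0, hn⟩) := by
  have hn' : (0 : ℝ) < n := by exact_mod_cast hn
  have hγ := gramEig_pos x hK ⟨0, hn⟩
  set γ := gramEig H x ⟨0, hn⟩ with hγdef
  have hH := gram_isHermitian H x
  constructor
  · obtain ⟨i, hi⟩ := gramEig_eq (H := H) x (⟨0, hn⟩ : Fin n)
    rw [← hγdef] at hi
    set e := ((gram_isHermitian H x).eigenvectorBasis i).ofLp with he
    have hKe : (gram H x).mulVec e = γ • e := by
      rw [← hi]; exact (gram_isHermitian H x).mulVec_eigenvectorBasis i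
    have hee : e ⬝ᵥ e = 1 := by rw [← l2norm_sq, he, l2norm_eigenvectorBasis, one_pow]
    have hsq : √(2 * n * a) ^ 2 = 2 * n * a := Real.sq_sqrt (by positivity)
    -- The minimizer is displaced from K⁻¹y along a top eigenvector e, with length chosen so that
    -- ‖Kb‖² = 2na.
    refine ⟨estimator H x (alphaHat x fstar + (√(2 * n * a) / γ) • e), ⟨_, rfl, ?_⟩, ?_⟩
    · rw [trainingLoss, residual_eq_mulVec x fstar hK, add_sub_cancel_left, mulVec_smul, hKe,
        l2norm_sq]
      simp only [smul_dotProduct, dotProduct_smul, smul_eq_mul, hee]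
      field_simp
      rw [hsq]
    · rw [estimationError_estimator x fstar hK, add_sub_cancel_left, mulVec_smul, hKe]
      simp only [smul_dotProduct, dotProduct_smul, smul_eq_mul, hee]
      field_simp
      rw [hsq]
  · rintro _ ⟨_, ⟨α, rfl, hα⟩, rfl⟩
    rw [estimationError_estimator x fstar hK, div_le_iff₀' hγ]
    refine le_trans (le_of_eq ?_) (l2norm_mulVec_sq_le (gram_isHermitian H x)
      (fun i => (hK.eigenvalues_pos i).le) (eigenvalues_le_gramEig x hn) _)
    rw [← residual_eq_mulVec x fstar hK, ← hα, trainingLoss]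
    field_simp

theorem bestError_eq (x : Fin n → X) (fstar : H) (hK : (gram H x).PosDef)
    (hn : 0 < n) {a : ℝ} (ha : 0 ≤ a) :
    bestError x fstar a = 2 * n * a / gramEig H x ⟨0, hn⟩ :=
  (isLeast_estimationError x fstar hK hn ha).csInf_eq

end EstimationError

/-! ### Gradient descent in eigencoordinates, and a logarithmic rate. -/

section GradientDescent

/-- With y = Ka and K symmetric the error obeys b ↦ (1 - (η/n)K²)b, which is diagonal in the
eigenbasis. -/
theorem coord_gdIterate {K : Matrix (Fin n) (Fin n) ℝ} (hK : K.IsHermitian) (a : Fin n → ℝ)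
    (η : ℝ) (α₀ : Fin n → ℝ) (k : ℕ) (i : Fin n) :
    coord hK (gdIterate K (K.mulVec a) η α₀ k - a) i =
      (1 - η / n * hK.eigenvalues i ^ 2) ^ k * coord hK (α₀ - a) i := by
  have hT : Kᵀ = K := by rw [← conjTranspose_eq_transpose_of_trivial]; exact hK
  induction k with
  | zero => simp [gdIterate]
  | succ k ih =>
    have h : gdIterate K (K.mulVec a) η α₀ (k + 1) - a = (gdIterate K (K.mulVec a) η α₀ k - a) -
        (η / n) • K.mulVec (K.mulVec (gdIterate K (K.mulVec a) η α₀ k - a)) := by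
      rw [gdIterate, hT, mulVec_sub K _ a]; abel
    rw [h, coord_sub, coord_smul, coord_mulVec, coord_mulVec, ih, pow_succ]
    ring

/-- For nonnegative weights `c i` and rates `0 < q i`, those with values above the bottom value
`m` having the smaller rates, the weighted excess over `m` is eventually an `ε` fraction, and
logarithmically many steps suffice. -/
theorem exists_log_rate {ι : Type*} [Fintype ι] (c d q : ι → ℝ) (q₀ W L : ℝ)
    (hc : ∀ i, 0 ≤ c i) (hd : ∀ i, 0 ≤ d i) (hq : ∀ i, 0 ≤ q i) (hq₀ : 0 < q₀)
    (hd' : ∀ i, d i ≠ 0 → q i < q₀) (hW : 0 < W) (hL : 0 < L) :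
    ∃ D : ℝ, ∀ ε : ℝ, 0 < ε → L ≤ Real.log (1 / ε) → ∀ k : ℕ, D * Real.log (1 / ε) ≤ k →
      ∑ i, d i * (q i ^ k * c i) ≤ ε * (q₀ ^ k * W) := by
  -- Finitely many strict inequalities leave a common ratio r < 1.
  obtain ⟨r, hr0, hr1, hr⟩ : ∃ r : ℝ, 0 < r ∧ r < 1 ∧ ∀ i, d i ≠ 0 → q i ≤ r * q₀ := by
    have h : ∀ s : Finset ι, ∃ r : ℝ, 0 < r ∧ r < 1 ∧ ∀ i ∈ s, d i ≠ 0 → q i ≤ r * q₀ := by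
      classical
      intro s
      induction s using Finset.induction_on with
      | empty => exact ⟨1 / 2, by norm_num, by norm_num, by simp⟩
      | insert i s _ ih =>
        obtain ⟨r, h0, h1, h⟩ := ih
        by_cases hi : d i = 0
        · refine ⟨r, h0, h1, fun j hj hdj => ?_⟩
          rcases Finset.mem_insert.1 hj with rfl | hj
          · exact absurd hi hdj
          · exact h j hj hdj
        · refine ⟨max r (q i / q₀), lt_max_of_lt_left h0,
            max_lt h1 ((div_lt_one hq₀).2 (hd' i hi)), fun j hj hdj => ?_⟩
          rcases Finset.mem_insert.1 hj with rfl | hj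
          · exact (div_le_iff₀ hq₀).1 (le_max_right _ _)
          · exact (h j hj hdj).trans (mul_le_mul_of_nonneg_right (le_max_left _ _) hq₀.le)
    obtain ⟨r, h0, h1, h⟩ := h Finset.univ
    exact ⟨r, h0, h1, fun i => h i (Finset.mem_univ i)⟩
  set S := ∑ i, d i * c i with hS
  have hS0 : 0 ≤ S := Finset.sum_nonneg fun i _ => mul_nonneg (hd i) (hc i)
  have hlr : 0 < -Real.log r := by linarith [Real.log_neg hr0 hr1]
  -- The steps needed are (P + log(1/ε))/(-log r) at most. The lower bound L on log(1/ε) turns the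
  -- additive P into a multiple of log(1/ε). Using S + 1 keeps the logarithm's argument positive
  -- when S = 0.
  set P := max 0 (Real.log ((S + 1) / W)) with hP
  refine ⟨(P / L + 1) / (-Real.log r), fun ε hε hεL k hk => ?_⟩
  have hlog : 0 < Real.log (1 / ε) := hL.trans_le hεL
  have hrk : (S + 1) / W * r ^ k ≤ ε := by
    have hpos : 0 < (S + 1) / W := by positivity
    rw [← Real.log_le_log_iff (by positivity) hε, Real.log_mul hpos.ne' (by positivity),
      Real.log_pow]
    have h1 : P ≤ P / L * Real.log (1 / ε) := by
      rw [div_mul_eq_mul_div, le_div_iff₀ hL]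
      exact mul_le_mul_of_nonneg_left hεL (le_max_left _ _)
    have h2 : (P / L + 1) * Real.log (1 / ε) ≤ k * (-Real.log r) := by
      rw [div_mul_eq_mul_div, div_le_iff₀ hlr] at hk
      exact hk
    have h3 : Real.log ((S + 1) / W) ≤ P := le_max_right _ _
    have h4 : Real.log (1 / ε) = -Real.log ε := by rw [one_div, Real.log_inv]
    rw [h4] at h1 h2
    linarith
  calc ∑ i, d i * (q i ^ k * c i) ≤ ∑ i, d i * c i * (r * q₀) ^ k := by
        refine Finset.sum_le_sum fun i _ => ?_
        by_cases hi : d i = 0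
        · simp [hi]
        · have := pow_le_pow_left₀ (hq i) (hr i hi) k
          have h2 := mul_le_mul_of_nonneg_left this (mul_nonneg (hd i) (hc i))
          linarith
    _ = S * (r * q₀) ^ k := by rw [hS, Finset.sum_mul]
    _ ≤ (S + 1) * (r * q₀) ^ k :=
        mul_le_mul_of_nonneg_right (by linarith) (by positivity)
    _ = ((S + 1) / W * r ^ k) * (q₀ ^ k * W) := by rw [mul_pow]; field_simp
    _ ≤ ε * (q₀ ^ k * W) := mul_le_mul_of_nonneg_right hrk (by positivity)

end GradientDescent

/-! ### Eigenvalue bounds from small off-diagonal entries. -/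

section SmallOffDiag

variable {K : Matrix (Fin n) (Fin n) ℝ} {τ : ℝ}

theorem l2norm_sq_eq_sum (v : Fin n → ℝ) : l2norm v ^ 2 = ∑ i, v i ^ 2 := by
  rw [l2norm_sq, dotProduct]
  exact Finset.sum_congr rfl fun i _ => (sq _).symm

/-- The off-diagonal part is at most τ(∑|vᵢ|)², and Cauchy–Schwarz bounds (∑|vᵢ|)² by n‖v‖². -/
theorem HasSmallOffDiag.abs_quadForm_sub_le (h : HasSmallOffDiag K τ) (v : Fin n → ℝ) :
    |v ⬝ᵥ K.mulVec v - ∑ i, K i i * v i ^ 2| ≤ n * τ * l2norm v ^ 2 := by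
  have h1 : v ⬝ᵥ K.mulVec v - ∑ i, K i i * v i ^ 2 =
      ∑ i, ∑ j, if i = j then 0 else v i * K i j * v j := by
    simp only [dotProduct, mulVec]
    rw [← Finset.sum_sub_distrib]
    refine Finset.sum_congr rfl fun i _ => ?_
    have : K i i * v i ^ 2 = ∑ j, if i = j then v i * K i j * v j else 0 := by
      rw [Finset.sum_ite_eq]; simp; ring
    rw [this, Finset.mul_sum, ← Finset.sum_sub_distrib]
    refine Finset.sum_congr rfl fun j _ => ?_
    split_ifs <;> ring
  have h2 : ∀ i j, |if i = j then 0 else v i * K i j * v j| ≤ τ * (|v i| * |v j|) := by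
    intro i j
    split_ifs with hij
    · rw [abs_zero]; have := h.tau_nonneg; positivity
    · rw [abs_mul, abs_mul]
      have := mul_le_mul_of_nonneg_right (h.off_diag i j hij)
        (mul_nonneg (abs_nonneg (v i)) (abs_nonneg (v j)))
      linarith
  have h3 : (∑ i, |v i|) ^ 2 ≤ n * l2norm v ^ 2 := by
    have := sq_sum_le_card_mul_sum_sq (s := Finset.univ) (f := fun i => |v i|)
    simpa [l2norm_sq_eq_sum] using this
  rw [h1]
  calc _ ≤ ∑ i, |∑ j, if i = j then 0 else v i * K i j * v j| := Finset.abs_sum_le_sum_abs _ _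
    _ ≤ ∑ i, ∑ j, τ * (|v i| * |v j|) := Finset.sum_le_sum fun i _ =>
        (Finset.abs_sum_le_sum_abs _ _).trans (Finset.sum_le_sum fun j _ => h2 i j)
    _ = τ * (∑ i, |v i|) ^ 2 := by
        rw [sq, Finset.sum_mul_sum, Finset.mul_sum]
        exact Finset.sum_congr rfl fun i _ => by rw [Finset.mul_sum]
    _ ≤ τ * (n * l2norm v ^ 2) := mul_le_mul_of_nonneg_left h3 h.tau_nonneg
    _ = n * τ * l2norm v ^ 2 := by ring

theorem HasSmallOffDiag.quadForm_le (h : HasSmallOffDiag K τ) (hn : 0 < n) (v : Fin n → ℝ) :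
    v ⬝ᵥ K.mulVec v ≤ (K ⟨0, hn⟩ ⟨0, hn⟩ + n * τ) * l2norm v ^ 2 := by
  have h1 := (abs_le.1 (h.abs_quadForm_sub_le v)).2
  have h2 : ∑ i, K i i * v i ^ 2 ≤ K ⟨0, hn⟩ ⟨0, hn⟩ * l2norm v ^ 2 := by
    rw [l2norm_sq_eq_sum, Finset.mul_sum]
    exact Finset.sum_le_sum fun i _ => mul_le_mul_of_nonneg_right
      (h.diag_antitone (by rw [Fin.le_def]; simp)) (sq_nonneg _)
  linarith

theorem HasSmallOffDiag.le_quadForm (h : HasSmallOffDiag K τ) (hn : n - 1 < n)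
    (v : Fin n → ℝ) :
    (K ⟨n - 1, hn⟩ ⟨n - 1, hn⟩ - n * τ) * l2norm v ^ 2 ≤ v ⬝ᵥ K.mulVec v := by
  have h1 := (abs_le.1 (h.abs_quadForm_sub_le v)).1
  have h2 : K ⟨n - 1, hn⟩ ⟨n - 1, hn⟩ * l2norm v ^ 2 ≤ ∑ i, K i i * v i ^ 2 := by
    rw [l2norm_sq_eq_sum, Finset.mul_sum]
    exact Finset.sum_le_sum fun i _ => mul_le_mul_of_nonneg_right
      (h.diag_antitone (by rw [Fin.le_def]; exact Nat.le_sub_one_of_lt i.isLt)) (sq_nonneg _)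
  linarith

theorem quadForm_eigenvectorBasis (hK : K.IsHermitian) (i : Fin n) :
    (hK.eigenvectorBasis i).ofLp ⬝ᵥ K.mulVec (hK.eigenvectorBasis i).ofLp =
      hK.eigenvalues i := by
  rw [hK.mulVec_eigenvectorBasis, dotProduct_smul, ← l2norm_sq, l2norm_eigenvectorBasis]
  simp

theorem HasSmallOffDiag.eigenvalues_le (h : HasSmallOffDiag K τ) (hK : K.IsHermitian)
    (hn : 0 < n) (i : Fin n) : hK.eigenvalues i ≤ K ⟨0, hn⟩ ⟨0, hn⟩ + n * τ := by
  have := h.quadForm_le hn (hK.eigenvectorBasis i).ofLp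
  rwa [quadForm_eigenvectorBasis, l2norm_eigenvectorBasis, one_pow, mul_one] at this

theorem HasSmallOffDiag.le_eigenvalues (h : HasSmallOffDiag K τ) (hK : K.IsHermitian)
    (hn : n - 1 < n) (i : Fin n) : K ⟨n - 1, hn⟩ ⟨n - 1, hn⟩ - n * τ ≤ hK.eigenvalues i := by
  have := h.le_quadForm hn (hK.eigenvectorBasis i).ofLp
  rwa [quadForm_eigenvectorBasis, l2norm_eigenvectorBasis, one_pow, mul_one] at this

end SmallOffDiag

/-! ### Gradient descent converges towards the bottom eigenspace. -/

section GradientDescent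

variable {X : Type*} {H : Type*} [NormedAddCommGroup H] [InnerProductSpace ℝ H]
  [CompleteSpace H] [RKHS ℝ H X ℝ]

/-- Gradient descent with a small step aligns with the bottom eigenspace at a linear rate. -/
theorem exists_log_gdIterate {K : Matrix (Fin n) (Fin n) ℝ} (hK : K.IsHermitian)
    (a α₀ : Fin n → ℝ) {η γ L : ℝ} (hγ : 0 < γ) (hmin : ∀ i, γ ≤ hK.eigenvalues i)
    (hη : 0 < η / n) (hη' : ∀ i, η / n * hK.eigenvalues i ^ 2 < 1)
    (hv : ∃ v : Fin n → ℝ, K.mulVec v = γ • v ∧ v ⬝ᵥ (α₀ - a) ≠ 0) (hL : 0 < L) :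
    ∃ D : ℝ, ∀ ε : ℝ, 0 < ε → L ≤ Real.log (1 / ε) → ∀ k : ℕ, D * Real.log (1 / ε) ≤ k →
      0 < l2norm (gdIterate K (K.mulVec a) η α₀ k - a) ∧
      l2norm (K.mulVec (gdIterate K (K.mulVec a) η α₀ k - a)) ^ 2 ≤
        (1 + ε) * (γ ^ 2 * l2norm (gdIterate K (K.mulVec a) η α₀ k - a) ^ 2) := by
  obtain ⟨v, hv, hvb⟩ := hv
  -- The coordinates of v vanish off the γ-eigenspace, so a nonzero pairing with v forces a nonzero
  -- coordinate of the initial error inside it.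
  obtain ⟨i₀, hi₀, hc₀⟩ : ∃ i, hK.eigenvalues i = γ ∧ coord hK (α₀ - a) i ≠ 0 := by
    rw [dotProduct_eq_sum_coord hK] at hvb
    obtain ⟨i, -, hi⟩ := Finset.exists_ne_zero_of_sum_ne_zero hvb
    refine ⟨i, ?_, right_ne_zero_of_mul hi⟩
    have h := coord_mulVec hK v i
    rw [hv, coord_smul] at h
    exact (mul_right_cancel₀ (left_ne_zero_of_mul hi) h).symm
  set b : ℕ → Fin n → ℝ := fun k => gdIterate K (K.mulVec a) η α₀ k - a with hb
  set q : Fin n → ℝ := fun i => 1 - η / n * hK.eigenvalues i ^ 2 with hq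
  have hq0 : ∀ i, 0 < q i := fun i => sub_pos.2 (hη' i)
  have hcoord : ∀ k i, coord hK (b k) i ^ 2 = (q i ^ 2) ^ k * coord hK (α₀ - a) i ^ 2 := by
    intro k i
    rw [hb, coord_gdIterate, mul_pow, ← pow_mul, ← pow_mul, mul_comm k 2]
  have hrate : ∀ i, hK.eigenvalues i ^ 2 - γ ^ 2 ≠ 0 → q i ^ 2 < q i₀ ^ 2 := by
    intro i hi
    have h1 : γ ^ 2 < hK.eigenvalues i ^ 2 :=
      lt_of_le_of_ne (pow_le_pow_left₀ hγ.le (hmin i) 2) (fun h => hi (by linarith))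
    refine pow_lt_pow_left₀ ?_ (hq0 i).le two_ne_zero
    simp only [hq, hi₀]
    have := mul_lt_mul_of_pos_left h1 hη
    linarith
  obtain ⟨D, hD⟩ := exists_log_rate (fun i => coord hK (α₀ - a) i ^ 2)
    (fun i => hK.eigenvalues i ^ 2 - γ ^ 2) (fun i => q i ^ 2) (q i₀ ^ 2)
    (γ ^ 2 * coord hK (α₀ - a) i₀ ^ 2) L (fun i => sq_nonneg _)
    (fun i => sub_nonneg.2 (pow_le_pow_left₀ hγ.le (hmin i) 2)) (fun i => sq_nonneg _)
    (pow_pos (hq0 i₀) 2) hrate (by positivity) hL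
  refine ⟨D, fun ε hε hεL k hk => ?_⟩
  have h1 : (q i₀ ^ 2) ^ k * coord hK (α₀ - a) i₀ ^ 2 ≤ l2norm (b k) ^ 2 := by
    rw [← hcoord, l2norm_sq_eq_sum_coord hK]
    exact Finset.single_le_sum (f := fun i => coord hK (b k) i ^ 2)
      (fun i _ => sq_nonneg _) (Finset.mem_univ i₀)
  -- The excess over γ²‖b‖² carries no contribution from the bottom eigenspace, so all its terms
  -- decay strictly faster than the coordinate i₀.
  have h2 : l2norm (K.mulVec (b k)) ^ 2 - γ ^ 2 * l2norm (b k) ^ 2 =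
      ∑ i, (hK.eigenvalues i ^ 2 - γ ^ 2) * ((q i ^ 2) ^ k * coord hK (α₀ - a) i ^ 2) := by
    rw [l2norm_mulVec_sq_eq_sum hK, l2norm_sq_eq_sum_coord hK, Finset.mul_sum,
      ← Finset.sum_sub_distrib]
    exact Finset.sum_congr rfl fun i _ => by rw [hcoord]; ring
  have h3 := hD ε hε hεL k hk
  rw [← h2] at h3
  have h4 : 0 < (q i₀ ^ 2) ^ k * coord hK (α₀ - a) i₀ ^ 2 := by
    have := hq0 i₀
    positivity
  refine ⟨lt_of_le_of_ne (l2norm_nonneg _) fun h => ?_, ?_⟩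
  · rw [← h] at h1; simp only [ne_eq, OfNat.ofNat_ne_zero, not_false_eq_true, zero_pow] at h1
    linarith
  · have h5 := mul_le_mul_of_nonneg_left h1 (mul_nonneg hε.le (sq_nonneg γ))
    have h6 : b k = gdIterate K (K.mulVec a) η α₀ k - a := rfl
    rw [← h6]
    linarith

theorem gd_estimationError (h0 : 0 < n) (hl : n - 1 < n) (x : Fin n → X) (fstar : H)
    (α₀ : Fin n → ℝ) (τ η : ℝ) (hK : (gram H x).PosDef) (hτ : HasSmallOffDiag (gram H x) τ)
    (hη : 0 < η) (hη' : η < n / (gram H x ⟨0, h0⟩ ⟨0, h0⟩ + n * τ) ^ 2)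
    (hv : ∃ v : Fin n → ℝ, (gram H x).mulVec v = gramEig H x ⟨n - 1, hl⟩ • v ∧
        v ⬝ᵥ (α₀ - alphaHat x fstar) ≠ 0) :
      ∃ D : ℝ, ∀ ε' : ℝ, 0 < ε' →
        ε' < 1 - gramEig H x ⟨n - 1, hl⟩ / gramEig H x ⟨0, h0⟩ →
        ∀ k : ℕ, D * Real.log (1 / ε') ≤ k →
        ∀ α : Fin n → ℝ, α = gdIterate (gram H x) (labels x fstar) η α₀ k →
        (gramEig H x ⟨n - 1, hl⟩ ≤
            l2norm ((gram H x).mulVec (α - alphaHat x fstar)) / l2norm (α - alphaHat x fstar) ∧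
          l2norm ((gram H x).mulVec (α - alphaHat x fstar)) / l2norm (α - alphaHat x fstar) ≤
            √(1 + ε') * gramEig H x ⟨n - 1, hl⟩) ∧
        1 < gramEig H x ⟨0, h0⟩ / gramEig H x ⟨n - 1, hl⟩ * (1 - ε') ∧
        gramEig H x ⟨0, h0⟩ / gramEig H x ⟨n - 1, hl⟩ * (1 - ε') *
            bestError x fstar (trainingLoss x fstar α) ≤
          estimationError x fstar (estimator H x α) := by
  have hn' : (0 : ℝ) < n := by exact_mod_cast h0
  have hH := gram_isHermitian H x
  have hγ₁ := gramEig_pos x hK ⟨0, by omega⟩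
  have hγₙ := gramEig_pos x hK ⟨n - 1, by omega⟩
  have hmin := gramEig_le_eigenvalues (H := H) x (by omega)
  have hmax := eigenvalues_le_gramEig (H := H) x (by omega)
  have hbest := fun α => bestError_eq x fstar hK (by omega)
    (show 0 ≤ trainingLoss x fstar α by rw [trainingLoss]; positivity)
  set γ₁ := gramEig H x ⟨0, by omega⟩ with hγ₁def
  set γₙ := gramEig H x ⟨n - 1, by omega⟩ with hγₙdef
  -- Otherwise no admissible ε' exists and any D will do.
  by_cases hlt : γₙ / γ₁ < 1
  swap
  · exact ⟨0, fun ε' h1 h2 => by exfalso; linarith [not_lt.1 hlt]⟩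
  have hL : 0 < Real.log (1 / (1 - γₙ / γ₁)) := by
    have := div_pos hγₙ hγ₁
    exact Real.log_pos ((one_lt_div (by linarith)).2 (by linarith))
  have hstep : ∀ i, η / n * hH.eigenvalues i ^ 2 < 1 := by
    intro i
    have h1 := hτ.eigenvalues_le hH (by omega) i
    have h2 := hK.eigenvalues_pos i
    have h3 : hH.eigenvalues i ^ 2 ≤ (gram H x ⟨0, by omega⟩ ⟨0, by omega⟩ + n * τ) ^ 2 :=
      pow_le_pow_left₀ h2.le h1 2
    have h4 : 0 < hH.eigenvalues i ^ 2 := pow_pos h2 2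
    rw [lt_div_iff₀ (h4.trans_le h3)] at hη'
    rw [div_mul_eq_mul_div, div_lt_one hn']
    exact (mul_le_mul_of_nonneg_left h3 hη.le).trans_lt hη'
  obtain ⟨D, hD⟩ := exists_log_gdIterate hH (alphaHat x fstar) α₀ (η := η) hγₙ hmin
    (div_pos hη hn') hstep hv hL
  refine ⟨D, fun ε hε hε1 k hk α hα => ?_⟩
  have hlog : Real.log (1 / (1 - γₙ / γ₁)) ≤ Real.log (1 / ε) :=
    Real.log_le_log (by rw [one_div, inv_pos]; linarith)
      (one_div_le_one_div_of_le hε hε1.le)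
  obtain ⟨hpos, hle⟩ := hD ε hε hlog k hk
  rw [gram_mulVec_alphaHat x fstar hK, ← hα] at hpos hle
  set b := α - alphaHat x fstar with hb
  have hlow : γₙ * l2norm b ≤ l2norm ((gram H x).mulVec b) :=
    le_l2norm_mulVec hH hγₙ.le hmin b
  have hM : 1 < γ₁ / γₙ * (1 - ε) := by
    have h1 : γₙ / γ₁ < 1 - ε := by linarith
    rw [div_lt_iff₀ hγ₁] at h1
    rw [div_mul_eq_mul_div, lt_div_iff₀ hγₙ]
    linarith
  refine ⟨⟨(le_div_iff₀ hpos).2 hlow, (div_le_iff₀ hpos).2 ?_⟩, hM, ?_⟩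
  · refine (sq_le_sq₀ (l2norm_nonneg _) (by positivity)).1 (hle.trans (le_of_eq ?_))
    rw [mul_pow, mul_pow, Real.sq_sqrt (by linarith)]
    ring
  · rw [hbest, estimationError_estimator x fstar hK, trainingLoss,
      residual_eq_mulVec x fstar hK, ← hb]
    have hq := le_quadForm hH hmin b
    -- It remains to use (1-ε)‖Kb‖² ≤ (1-ε)(1+ε)γₙ²‖b‖² ≤ γₙ²‖b‖² ≤ γₙ bᵀKb.
    have e : γ₁ / γₙ * (1 - ε) * (2 * n * (1 / (2 * n) * l2norm ((gram H x).mulVec b) ^ 2) / γ₁)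
        = (1 - ε) * l2norm ((gram H x).mulVec b) ^ 2 / γₙ := by field_simp
    rw [e, div_le_iff₀ hγₙ]
    have h1 : (1 - ε) * l2norm ((gram H x).mulVec b) ^ 2 ≤
        (1 - ε) * ((1 + ε) * (γₙ ^ 2 * l2norm b ^ 2)) := by
      refine mul_le_mul_of_nonneg_left hle ?_
      have := div_pos hγₙ hγ₁
      linarith
    have h2 : 0 ≤ ε ^ 2 * (γₙ ^ 2 * l2norm b ^ 2) := by positivity
    have h3 := mul_le_mul_of_nonneg_left hq hγₙ.le
    linarith

end GradientDescent

/-! ### One SGD step, split along u and orthogonally to u. -/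

section RankOneSteps

variable {E ι : Type*} [NormedAddCommGroup E] [InnerProductSpace ℝ E]

/-- The update `b - η ⟪k, b⟫ k`. -/
def rankOneStep (η : ℝ) (k b : E) : E := b - (η * inner ℝ k b) • k

/-- The component of `b` orthogonal to the unit vector `u`. -/
def perp (u b : E) : E := b - inner ℝ u b • u

/-- Expand ‖b'‖² for the updated vector b' and use 2‖b'‖‖b‖ ≤ ‖b'‖² + ‖b‖². Dividing by ‖b‖ later
gives a contraction of the norm itself, as first moments require. -/
theorem norm_rankOneStep_mul_le {η M : ℝ} (hη : 0 ≤ η) {k : E} (hk : ‖k‖ ^ 2 ≤ M) (b : E) :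
    ‖rankOneStep η k b‖ * ‖b‖ ≤ ‖b‖ ^ 2 - η / 2 * (2 - η * M) * inner ℝ k b ^ 2 := by
  have h1 : ‖rankOneStep η k b‖ ^ 2 = ‖b‖ ^ 2 - η * (2 - η * ‖k‖ ^ 2) * inner ℝ k b ^ 2 := by
    rw [rankOneStep, norm_sub_sq_real, norm_smul, inner_smul_right, real_inner_comm, mul_pow,
      Real.norm_eq_abs, sq_abs]
    ring
  have h2 : η * inner ℝ k b ^ 2 * (η * ‖k‖ ^ 2) ≤ η * inner ℝ k b ^ 2 * (η * M) :=
    mul_le_mul_of_nonneg_left (mul_le_mul_of_nonneg_left hk hη) (by positivity)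
  have h3 := two_mul_le_add_sq ‖rankOneStep η k b‖ ‖b‖
  linarith

/-- The vectors `k i` with `i ≠ i₀` are orthogonal to the unit vector `u`, and `k i₀` is nearly
parallel to it. -/
structure IsNearlyAligned [Fintype ι] (k : ι → E) (i₀ : ι) (u : E) (μ ω σ M : ℝ) : Prop where
  norm_eq : ‖u‖ = 1
  inner_eq : inner ℝ u (k i₀) = μ
  mu_pos : 0 < μ
  omega_nonneg : 0 ≤ ω
  inner_eq_zero : ∀ i, i ≠ i₀ → inner ℝ u (k i) = 0
  abs_inner_le : ∀ v, inner ℝ u v = 0 → |inner ℝ (k i₀) v| ≤ ω * ‖v‖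
  frame : ∀ v, σ * ‖v‖ ^ 2 ≤ ∑ i, inner ℝ (k i) v ^ 2
  norm_sq_le : ∀ i, i ≠ i₀ → ‖k i‖ ^ 2 ≤ M

theorem inner_perp {u : E} (hu : ‖u‖ = 1) (b : E) : inner ℝ u (perp u b) = 0 := by
  rw [perp, inner_sub_right, inner_smul_right, real_inner_self_eq_norm_sq, hu]; ring

theorem perp_rankOneStep_eq (η : ℝ) (u k b : E) :
    perp u (rankOneStep η k b) = perp u b - (η * inner ℝ k b) • perp u k := by
  rw [perp, rankOneStep, inner_sub_right, inner_smul_right, perp, perp, smul_sub, sub_smul,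
    smul_smul]
  abel

namespace IsNearlyAligned

variable [Fintype ι] {k : ι → E} {i₀ : ι} {u : E} {μ ω σ M : ℝ}

/-- Apply the near-alignment bound to v = `perp u (k i₀)` itself. -/
theorem norm_perp_le (h : IsNearlyAligned k i₀ u μ ω σ M) : ‖perp u (k i₀)‖ ≤ ω := by
  have h1 := inner_perp h.norm_eq (k i₀)
  have h2 := h.abs_inner_le _ h1
  have h3 : inner ℝ (k i₀) (perp u (k i₀)) = ‖perp u (k i₀)‖ ^ 2 := by
    rw [← real_inner_self_eq_norm_sq]
    nth_rewrite 2 [perp]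
    rw [inner_sub_left, inner_smul_left, h1]; simp
  rw [h3, abs_of_nonneg (sq_nonneg _), sq] at h2
  rcases (norm_nonneg (perp u (k i₀))).eq_or_lt with h4 | h4
  · rw [← h4]; exact h.omega_nonneg
  · exact le_of_mul_le_mul_right h2 h4

theorem inner_eq_add (h : IsNearlyAligned k i₀ u μ ω σ M) (b : E) :
    inner ℝ (k i₀) b = μ * inner ℝ u b + inner ℝ (k i₀) (perp u b) := by
  rw [perp, inner_sub_right, inner_smul_right, real_inner_comm u, h.inner_eq]; ring

theorem inner_rankOneStep (h : IsNearlyAligned k i₀ u μ ω σ M) (η : ℝ) {i : ι} (hi : i ≠ i₀)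
    (b : E) : inner ℝ u (rankOneStep η (k i) b) = inner ℝ u b := by
  rw [rankOneStep, inner_sub_right, inner_smul_right, h.inner_eq_zero i hi]; ring

theorem inner_rankOneStep_self (h : IsNearlyAligned k i₀ u μ ω σ M) (η : ℝ) (b : E) :
    inner ℝ u (rankOneStep η (k i₀) b) =
      (1 - η * μ ^ 2) * inner ℝ u b - η * μ * inner ℝ (k i₀) (perp u b) := by
  rw [rankOneStep, inner_sub_right, inner_smul_right, h.inner_eq, h.inner_eq_add]; ring

theorem perp_rankOneStep (h : IsNearlyAligned k i₀ u μ ω σ M) (η : ℝ) {i : ι} (hi : i ≠ i₀)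
    (b : E) : perp u (rankOneStep η (k i) b) = rankOneStep η (k i) (perp u b) := by
  have h1 : inner ℝ (k i) (perp u b) = inner ℝ (k i) b := by
    rw [perp, inner_sub_right, inner_smul_right, real_inner_comm u, h.inner_eq_zero i hi]; ring
  rw [perp, h.inner_rankOneStep η hi, rankOneStep, rankOneStep, h1, perp]
  abel

theorem norm_perp_rankOneStep_self_le (h : IsNearlyAligned k i₀ u μ ω σ M) {η : ℝ}
    (hη : 0 ≤ η) (b : E) :
    ‖perp u (rankOneStep η (k i₀) b)‖ ≤
      ‖perp u b‖ + η * ω * (μ * |inner ℝ u b| + ω * ‖perp u b‖) := by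
  rw [perp_rankOneStep_eq]
  refine (norm_sub_le _ _).trans (add_le_add_right ?_ _)
  have h1 : |inner ℝ (k i₀) b| ≤ μ * |inner ℝ u b| + ω * ‖perp u b‖ := by
    rw [h.inner_eq_add]
    refine (abs_add_le _ _).trans (add_le_add ?_ (h.abs_inner_le _ (inner_perp h.norm_eq b)))
    rw [abs_mul, abs_of_pos h.mu_pos]
  rw [norm_smul, Real.norm_eq_abs, abs_mul, abs_of_nonneg hη]
  calc _ ≤ η * (μ * |inner ℝ u b| + ω * ‖perp u b‖) * ω :=
        mul_le_mul (mul_le_mul_of_nonneg_left h1 hη) h.norm_perp_le (norm_nonneg _)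
          (mul_nonneg hη ((abs_nonneg _).trans h1))
    _ = _ := by ring

variable [DecidableEq ι]

theorem sum_abs_inner_rankOneStep (h : IsNearlyAligned k i₀ u μ ω σ M) (η : ℝ) (b : E) :
    ∑ i, |inner ℝ u (rankOneStep η (k i) b)| =
      |inner ℝ u (rankOneStep η (k i₀) b)| + (Fintype.card ι - 1) * |inner ℝ u b| := by
  rw [← Finset.add_sum_erase _ _ (Finset.mem_univ i₀)]
  congr 1
  rw [Finset.sum_congr rfl fun i hi => by rw [h.inner_rankOneStep η (Finset.ne_of_mem_erase hi)],
    Finset.sum_const, Finset.card_erase_of_mem (Finset.mem_univ i₀), Finset.card_univ,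
    nsmul_eq_mul, Nat.cast_pred (Fintype.card_pos_iff.2 ⟨i₀⟩)]

/-- All indices but i₀ preserve |⟨u,b⟩|, and i₀ multiplies it by at least ημ² - 1 up to a cross
term. The total is therefore card + (ημ² - 2). -/
theorem le_sum_abs_inner_rankOneStep (h : IsNearlyAligned k i₀ u μ ω σ M) {η : ℝ}
    (hη : 0 ≤ η) (b : E) :
    (Fintype.card ι + (η * μ ^ 2 - 2)) * |inner ℝ u b| - η * μ * ω * ‖perp u b‖ ≤
      ∑ i, |inner ℝ u (rankOneStep η (k i) b)| := by
  rw [h.sum_abs_inner_rankOneStep, h.inner_rankOneStep_self]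
  have hμ := h.mu_pos
  have h1 : (η * μ ^ 2 - 1) * |inner ℝ u b| ≤ |(1 - η * μ ^ 2) * inner ℝ u b| := by
    rw [abs_mul, abs_sub_comm]
    exact mul_le_mul_of_nonneg_right (le_abs_self _) (abs_nonneg _)
  have h2 : |η * μ * inner ℝ (k i₀) (perp u b)| ≤ η * μ * (ω * ‖perp u b‖) := by
    rw [abs_mul, abs_of_nonneg (by positivity)]
    exact mul_le_mul_of_nonneg_left (h.abs_inner_le _ (inner_perp h.norm_eq b)) (by positivity)
  have h3 := abs_sub_abs_le_abs_sub ((1 - η * μ ^ 2) * inner ℝ u b)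
    (η * μ * inner ℝ (k i₀) (perp u b))
  linarith

/-- For the second stage, where i₀ may annihilate the component along u. -/
theorem le_sum_abs_inner_rankOneStep' (h : IsNearlyAligned k i₀ u μ ω σ M) (η : ℝ) (b : E) :
    (Fintype.card ι - 1) * |inner ℝ u b| ≤ ∑ i, |inner ℝ u (rankOneStep η (k i) b)| := by
  rw [h.sum_abs_inner_rankOneStep]
  linarith [abs_nonneg (inner ℝ u (rankOneStep η (k i₀) b))]

/-- Sum the contraction over i ≠ i₀ and bound ∑⟨kᵢ,v⟩² below by the frame inequality. Its i₀ term is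
at most ω²‖v‖², whence σ - ω². The step i₀ itself contributes only the cross terms. -/
theorem sum_norm_perp_rankOneStep_le (h : IsNearlyAligned k i₀ u μ ω σ M) {η : ℝ}
    (hη : 0 ≤ η) (hηM : η * M ≤ 2) (b : E) :
    ∑ i, ‖perp u (rankOneStep η (k i) b)‖ ≤
      (Fintype.card ι - η / 2 * (σ - ω ^ 2) * (2 - η * M)) * ‖perp u b‖ +
        η * ω * (μ * |inner ℝ u b| + ω * ‖perp u b‖) := by
  have h0 := h.norm_perp_rankOneStep_self_le hη b
  rw [← Finset.add_sum_erase _ _ (Finset.mem_univ i₀),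
    Finset.sum_congr rfl fun i hi => by rw [h.perp_rankOneStep η (Finset.ne_of_mem_erase hi)]]
  have hp := inner_perp h.norm_eq b
  set v := perp u b with hv
  have h1 : (∑ i ∈ Finset.univ.erase i₀, ‖rankOneStep η (k i) v‖) ≤
      (Fintype.card ι - 1 - η / 2 * (σ - ω ^ 2) * (2 - η * M)) * ‖v‖ := by
    rcases (norm_nonneg v).eq_or_lt with hv0 | hv0
    · have hv1 : v = 0 := norm_eq_zero.1 hv0.symm
      simp [hv1, rankOneStep]
    · refine le_of_mul_le_mul_right ?_ hv0
      rw [Finset.sum_mul]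
      have h2 := Finset.sum_le_sum fun i (hi : i ∈ Finset.univ.erase i₀) =>
        norm_rankOneStep_mul_le hη (h.norm_sq_le i (Finset.ne_of_mem_erase hi)) v
      rw [Finset.sum_sub_distrib, ← Finset.mul_sum, Finset.sum_const,
        Finset.card_erase_of_mem (Finset.mem_univ i₀), Finset.card_univ,
        nsmul_eq_mul, Nat.cast_pred (Fintype.card_pos_iff.2 ⟨i₀⟩)] at h2
      have h3 := h.frame v
      rw [← Finset.add_sum_erase _ _ (Finset.mem_univ i₀)] at h3
      have h4 : inner ℝ (k i₀) v ^ 2 ≤ (ω * ‖v‖) ^ 2 := by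
        rw [← sq_abs]
        exact pow_le_pow_left₀ (abs_nonneg _) (h.abs_inner_le v hp) 2
      have h5 : (σ - ω ^ 2) * ‖v‖ ^ 2 ≤ ∑ i ∈ Finset.univ.erase i₀, inner ℝ (k i) v ^ 2 := by
        linarith
      have h6 := mul_le_mul_of_nonneg_left h5
        (show 0 ≤ η / 2 * (2 - η * M) by have := sub_nonneg.2 hηM; positivity)
      linarith
  linarith

end IsNearlyAligned

end RankOneSteps

/-! ### The linear recursion for the two expected components. -/

section RatioRecursion

/-- If in each step `A` expands and `B` contracts with a total gap `2 θ / ν`, up to cross terms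
of relative size `h / ν`, then `B / A` decreases geometrically down to `r`. -/
theorem ratio_le_of_recursion {A B : ℕ → ℝ} {ν q s h θ Y ρ r : ℝ} {k : ℕ} (hν : 1 ≤ ν)
    (hq : q ≤ 1) (hs : 0 ≤ s) (hsY : 1 + s ≤ Y) (hθ : 0 < θ) (hθ1 : θ ≤ 1)
    (hgap : 2 * θ ≤ s + q) (hh : 0 ≤ h) (hr : 0 < r) (hrρ : r ≤ ρ)
    (hhr : h * (1 + r) ≤ θ / 2 * r) (hhρ : h * ρ ≤ θ / 2)
    (hA : ∀ t < k, (ν + s) * A t - h * B t ≤ ν * A (t + 1))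
    (hB : ∀ t < k, ν * B (t + 1) ≤ (ν - q) * B t + h * (A t + B t))
    (hA0 : 0 < A 0) (hB0 : B 0 ≤ ρ * A 0) :
    ∀ t ≤ k, 0 < A t ∧ B t ≤ max r (ρ * (1 - θ / (ν * Y)) ^ t) * A t := by
  have hY : 1 ≤ Y := by linarith
  have hνY : 1 ≤ ν * Y := one_le_mul_of_one_le_of_one_le hν hY
  set d := 1 - θ / (ν * Y) with hd
  have hd1 : d ≤ 1 := by have : 0 ≤ θ / (ν * Y) := by positivity
                         linarith
  have hd0 : 0 ≤ d := by
    have : θ / (ν * Y) ≤ 1 := (div_le_one (by linarith)).2 (by linarith)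
    linarith
  intro t
  induction t with
  | zero =>
    intro _
    refine ⟨hA0, hB0.trans (mul_le_mul_of_nonneg_right ?_ hA0.le)⟩
    simp
  | succ t ih =>
    intro ht
    obtain ⟨hpos, hle⟩ := ih (by omega)
    have hA' := hA t (by omega)
    have hB' := hB t (by omega)
    -- The current ratio bound m stays in [r, ρ]: m ≥ r makes the cross terms small relative to B's
    -- bound, m ≤ ρ makes them small relative to A.
    set m := max r (ρ * d ^ t) with hm
    have hrm : r ≤ m := le_max_left _ _
    have hmρ : m ≤ ρ :=
      max_le hrρ (mul_le_of_le_one_right (by linarith) (pow_le_one₀ hd0 hd1))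
    have hm0 : 0 < m := hr.trans_le hrm
    have h1 : h * (1 + m) ≤ θ / 2 * m := by
      have e1 : h * r ≤ h * m := mul_le_mul_of_nonneg_left hrm hh
      have e2 : h * (1 + r) * m ≤ θ / 2 * r * m := mul_le_mul_of_nonneg_right hhr hm0.le
      refine le_of_mul_le_mul_right ?_ hr
      linarith
    have h2 : h * m ≤ θ / 2 := (mul_le_mul_of_nonneg_left hmρ hh).trans hhρ
    have h3 : h * B t ≤ θ / 2 * A t := by
      calc h * B t ≤ h * (m * A t) := mul_le_mul_of_nonneg_left hle hh
        _ = h * m * A t := by ring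
        _ ≤ _ := mul_le_mul_of_nonneg_right h2 hpos.le
    have h4 : (ν + s - θ / 2) * A t ≤ ν * A (t + 1) := by linarith
    have h5 : ν * B (t + 1) ≤ m * ((ν - q + θ / 2) * A t) := by
      have e1 : (ν - q) * B t ≤ (ν - q) * (m * A t) :=
        mul_le_mul_of_nonneg_left hle (by linarith)
      have e2 : h * B t ≤ h * (m * A t) := mul_le_mul_of_nonneg_left hle hh
      have e3 : h * (1 + m) * A t ≤ θ / 2 * m * A t := mul_le_mul_of_nonneg_right h1 hpos.le
      linarith
    -- Each cross term costs θ/2 out of the gap 2θ. The θ left over pays for the factor d, because ν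
    -- + s ≤ νY.
    have h6 : ν - q + θ / 2 ≤ d * (ν + s - θ / 2) := by
      have e1 : θ / (ν * Y) * (ν + s - θ / 2) ≤ θ := by
        rw [div_mul_eq_mul_div, div_le_iff₀ (by linarith)]
        refine mul_le_mul_of_nonneg_left ?_ hθ.le
        have : 0 ≤ (ν - 1) * s := mul_nonneg (by linarith) hs
        have : ν * (1 + s) ≤ ν * Y := mul_le_mul_of_nonneg_left hsY (by linarith)
        linarith
      rw [hd]
      linarith
    have h7 : 0 < A (t + 1) := by
      have : 0 < (ν + s - θ / 2) * A t := mul_pos (by linarith) hpos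
      exact pos_of_mul_pos_right (this.trans_le h4) (by linarith)
    refine ⟨h7, ?_⟩
    have h8 : ν * B (t + 1) ≤ ν * (m * d * A (t + 1)) := by
      calc ν * B (t + 1) ≤ m * ((ν - q + θ / 2) * A t) := h5
        _ ≤ m * (d * (ν + s - θ / 2) * A t) :=
            mul_le_mul_of_nonneg_left (mul_le_mul_of_nonneg_right h6 hpos.le) hm0.le
        _ = m * d * ((ν + s - θ / 2) * A t) := by ring
        _ ≤ m * d * (ν * A (t + 1)) := mul_le_mul_of_nonneg_left h4 (mul_nonneg hm0.le hd0)
        _ = _ := by ring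
    refine (le_of_mul_le_mul_left h8 (by linarith)).trans
      (mul_le_mul_of_nonneg_right ?_ h7.le)
    rcases le_total r (ρ * d ^ t) with hc | hc
    · rw [hm, max_eq_right hc, mul_assoc, ← pow_succ]
      exact le_max_right _ _
    · rw [hm, max_eq_left hc]
      exact (mul_le_of_le_one_right hr.le hd1).trans (le_max_left _ _)

/-- From 1 - x ≤ exp(-x), about (N/θ)·log(16ρ/ε) steps suffice. As 1/ε > 4 > e, log(1/ε) ≥ 1 absorbs
the additive constants. -/
theorem exists_steps {θ N ρ ε : ℝ} (hθ : 0 < θ) (hN : θ ≤ N) (hρ : 1 ≤ ρ) (hε : 0 < ε)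
    (hε4 : ε < 1 / 4) :
    ∃ k : ℕ, 1 ≤ k ∧ (k : ℝ) ≤ (N / θ * (Real.log (16 * ρ) + 1) + 2) * Real.log (1 / ε) ∧
      ρ * (1 - θ / N) ^ k ≤ ε / 16 := by
  have hN0 : 0 < N := hθ.trans_le hN
  have hl : 1 ≤ Real.log (1 / ε) := by
    rw [Real.le_log_iff_exp_le (by positivity)]
    have h1 : (4 : ℝ) ≤ 1 / ε := by rw [le_div_iff₀ hε]; linarith
    have h2 := Real.exp_one_lt_d9
    linarith
  have hl16 : 0 ≤ Real.log (16 * ρ) := Real.log_nonneg (by linarith)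
  set x := N / θ * (Real.log (16 * ρ) + Real.log (1 / ε)) with hx
  have hx0 : 0 ≤ x := by positivity
  refine ⟨⌈x⌉₊ + 1, by omega, ?_, ?_⟩
  · have h1 := Nat.ceil_lt_add_one hx0
    push_cast
    have h2 : Real.log (16 * ρ) ≤ Real.log (16 * ρ) * Real.log (1 / ε) :=
      le_mul_of_one_le_right hl16 hl
    have h3 := mul_le_mul_of_nonneg_left h2 (show 0 ≤ N / θ by positivity)
    have h4 : x = N / θ * Real.log (16 * ρ) + N / θ * Real.log (1 / ε) := by rw [hx, mul_add]
    linarith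
  · have hk : x ≤ ((⌈x⌉₊ + 1 : ℕ) : ℝ) := by
      have := Nat.le_ceil x
      push_cast
      linarith
    set k := ⌈x⌉₊ + 1
    have h1 : (1 - θ / N) ^ k ≤ Real.exp (-(θ / N)) ^ k := by
      refine pow_le_pow_left₀ (sub_nonneg.2 ((div_le_one hN0).2 hN)) ?_ k
      have := Real.add_one_le_exp (-(θ / N))
      linarith
    rw [← Real.exp_nat_mul] at h1
    have h2 : Real.exp (k * (-(θ / N))) ≤ Real.exp (-(Real.log (16 * ρ) + Real.log (1 / ε))) := by
      refine Real.exp_le_exp.2 ?_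
      have h3 := mul_le_mul_of_nonneg_right hk (show 0 ≤ θ / N by positivity)
      have h4 : x * (θ / N) = Real.log (16 * ρ) + Real.log (1 / ε) := by rw [hx]; field_simp
      linarith
    rw [← Real.log_mul (by positivity) (by positivity), Real.exp_neg,
      Real.exp_log (by positivity)] at h2
    calc _ ≤ ρ * (16 * ρ * (1 / ε))⁻¹ := mul_le_mul_of_nonneg_left (h1.trans h2) (by linarith)
      _ = ε / 16 := by field_simp

end RatioRecursion

/-! ### Expectations over index sequences. -/

section Expectation

variable (K : Matrix (Fin n) (Fin n) ℝ) (y : Fin n → ℝ) (η : ℕ → ℝ) (α₀ : Fin n → ℝ)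

theorem sgdExpect_zero (F : (Fin n → ℝ) → ℝ) : sgdExpect K y η α₀ 0 F = F α₀ := by
  simp [sgdExpect, sgdIterate]

/-- Conditioning on all draws but the last: a sequence of length k + 1 is one of length k followed
by one index. -/
theorem sgdExpect_succ (k : ℕ) (F : (Fin n → ℝ) → ℝ) :
    sgdExpect K y η α₀ (k + 1) F =
      sgdExpect K y η α₀ k (fun α => ∑ i, F (sgdStep K y (η k) i α)) / n := by
  rw [sgdExpect, sgdExpect, div_div, ← pow_succ]
  congr 1
  rw [← (Fin.snocEquiv fun _ : Fin (k + 1) => Fin n).sum_comp, Fintype.sum_prod_type_right]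
  simp [Fin.snocEquiv, sgdIterate]

variable {K y η α₀}

theorem sgdExpect_mono (k : ℕ) {F G : (Fin n → ℝ) → ℝ} (h : ∀ α, F α ≤ G α) :
    sgdExpect K y η α₀ k F ≤ sgdExpect K y η α₀ k G :=
  div_le_div_of_nonneg_right (Finset.sum_le_sum fun _ _ => h _) (by positivity)

theorem sgdExpect_lin (k : ℕ) (F G : (Fin n → ℝ) → ℝ) (a b : ℝ) :
    sgdExpect K y η α₀ k (fun α => a * F α + b * G α) =
      a * sgdExpect K y η α₀ k F + b * sgdExpect K y η α₀ k G := by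
  simp only [sgdExpect, Finset.sum_add_distrib, ← Finset.mul_sum]
  ring

theorem sgdExpect_nonneg (k : ℕ) {F : (Fin n → ℝ) → ℝ} (h : ∀ α, 0 ≤ F α) :
    0 ≤ sgdExpect K y η α₀ k F :=
  div_nonneg (Finset.sum_nonneg fun _ _ => h _) (by positivity)

theorem le_sgdExpect_succ (hn : 0 < n) (k : ℕ) {F G L : (Fin n → ℝ) → ℝ} {a b : ℝ}
    (h : ∀ α, a * F α + b * G α ≤ ∑ i, L (sgdStep K y (η k) i α)) :
    a * sgdExpect K y η α₀ k F + b * sgdExpect K y η α₀ k G ≤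
      n * sgdExpect K y η α₀ (k + 1) L := by
  rw [sgdExpect_succ, mul_div_cancel₀ _ (by exact_mod_cast hn.ne'), ← sgdExpect_lin]
  exact sgdExpect_mono k h

theorem sgdExpect_succ_le (hn : 0 < n) (k : ℕ) {F G L : (Fin n → ℝ) → ℝ} {a b : ℝ}
    (h : ∀ α, ∑ i, L (sgdStep K y (η k) i α) ≤ a * F α + b * G α) :
    n * sgdExpect K y η α₀ (k + 1) L ≤
      a * sgdExpect K y η α₀ k F + b * sgdExpect K y η α₀ k G := by
  rw [sgdExpect_succ, mul_div_cancel₀ _ (by exact_mod_cast hn.ne'), ← sgdExpect_lin]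
  exact sgdExpect_mono k h

end Expectation

/-! ### Near alignment of the columns of the Gram matrix. -/

section NearlyDiagonal

variable {K : Matrix (Fin n) (Fin n) ℝ} {τ : ℝ}

theorem abs_dotProduct_le (v w : Fin n → ℝ) : |v ⬝ᵥ w| ≤ l2norm v * l2norm w := by
  rw [← inner_toLp]
  exact abs_real_inner_le_norm _ _

theorem abs_dotProduct_le_of_abs_le (hτ : 0 ≤ τ) {r : Fin n → ℝ} (hr : ∀ j, |r j| ≤ τ)
    (v : Fin n → ℝ) : |r ⬝ᵥ v| ≤ √n * τ * l2norm v := by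
  refine (abs_dotProduct_le r v).trans (mul_le_mul_of_nonneg_right ?_ (l2norm_nonneg v))
  refine (sq_le_sq₀ (l2norm_nonneg r) (by positivity)).1 ?_
  rw [mul_pow, Real.sq_sqrt (by positivity), l2norm_sq_eq_sum]
  calc ∑ i, r i ^ 2 ≤ ∑ _i : Fin n, τ ^ 2 := Finset.sum_le_sum fun i _ => by
        rw [← sq_abs]; exact pow_le_pow_left₀ (abs_nonneg _) (hr i) 2
    _ = n * τ ^ 2 := by simp

theorem HasSmallOffDiag.abs_row_dotProduct_sub_le (h : HasSmallOffDiag K τ) (i : Fin n)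
    (v : Fin n → ℝ) : |K i ⬝ᵥ v - K i i * v i| ≤ √n * τ * l2norm v := by
  have e : K i ⬝ᵥ v - K i i * v i = (fun j => if j = i then 0 else K i j) ⬝ᵥ v := by
    simp only [dotProduct]
    rw [← Finset.add_sum_erase _ _ (Finset.mem_univ i),
      ← Finset.add_sum_erase _ (fun j => (if j = i then 0 else K i j) * v j) (Finset.mem_univ i)]
    rw [add_sub_cancel_left, if_pos rfl, zero_mul, zero_add]
    exact Finset.sum_congr rfl fun j hj => by rw [if_neg (Finset.ne_of_mem_erase hj)]
  rw [e]
  refine abs_dotProduct_le_of_abs_le h.tau_nonneg (fun j => ?_) v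
  split_ifs with hj
  · rw [abs_zero]; exact h.tau_nonneg
  · exact h.off_diag i j (Ne.symm hj)

theorem HasSmallOffDiag.l2norm_col_sq_le (h : HasSmallOffDiag K τ) (i : Fin n) :
    l2norm (K.col i) ^ 2 ≤ K i i ^ 2 + (√n * τ) ^ 2 := by
  rw [l2norm_sq_eq_sum, mul_pow, Real.sq_sqrt (by positivity)]
  calc ∑ j, K.col i j ^ 2 ≤ ∑ j, ((if j = i then K i i ^ 2 else 0) + τ ^ 2) := by
        refine Finset.sum_le_sum fun j _ => ?_
        split_ifs with hj
        · rw [hj, Matrix.col_apply]; linarith [sq_nonneg τ]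
        · rw [zero_add, Matrix.col_apply, ← sq_abs]
          exact pow_le_pow_left₀ (abs_nonneg _) (h.off_diag j i hj) 2
    _ = _ := by simp [Finset.sum_add_distrib]

theorem col_dotProduct (hK : K.IsHermitian) (i : Fin n) (v : Fin n → ℝ) :
    K.col i ⬝ᵥ v = K.mulVec v i := by
  have hT : Kᵀ = K := by rw [← conjTranspose_eq_transpose_of_trivial]; exact hK
  nth_rewrite 2 [← hT]
  rfl

theorem toLp_sgdStep_sub (hK : K.IsHermitian) (a : Fin n → ℝ) (η : ℝ) (i : Fin n)
    (α : Fin n → ℝ) :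
    WithLp.toLp 2 (sgdStep K (K.mulVec a) η i α - a) =
      rankOneStep η (WithLp.toLp 2 (K.col i)) (WithLp.toLp 2 (α - a)) := by
  rw [rankOneStep, inner_toLp, sgdStep, ← col_dotProduct hK, dotProduct_sub]
  rw [← WithLp.toLp_smul, ← WithLp.toLp_sub]
  congr 1
  abel

theorem sqrt_mul_le (hn : 1 ≤ n) (hτ : 0 ≤ τ) : √n * τ ≤ n * τ := by
  refine mul_le_mul_of_nonneg_right ?_ hτ
  have : (1 : ℝ) ≤ n := by exact_mod_cast hn
  exact Real.sqrt_le_iff.2 ⟨by positivity, by nlinarith⟩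

/-- The unit vector in the direction `K⁻¹ e₁` exhibits the columns of a symmetric matrix with
small off-diagonal entries as nearly aligned. -/
theorem exists_isNearlyAligned (hn : 2 ≤ n) (h0 : 0 < n) (h1 : 1 < n) (hl : n - 1 < n) (hK : K.IsHermitian) (h : HasSmallOffDiag K τ)
    {c₁ c₂ : ℝ} (hc₁ : 0 < c₁)
    (h₁ : c₁ ≤ K ⟨n - 1, hl⟩ ⟨n - 1, hl⟩ - n * τ)
    (h₂ : K ⟨0, h0⟩ ⟨0, h0⟩ + n * τ ≤ c₂) :
    ∃ (u : Fin n → ℝ) (μ : ℝ),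
      IsNearlyAligned (fun i => WithLp.toLp 2 (K.col i)) ⟨0, h0⟩ (WithLp.toLp 2 u) μ
        ((c₂ / c₁ + 1) * (√n * τ)) (c₁ ^ 2)
        (K ⟨1, h1⟩ ⟨1, h1⟩ ^ 2 + c₂ * (√n * τ)) ∧
      l2norm (K.mulVec u) = μ ∧
      (∀ b, ‖projFirst K b‖ = |inner ℝ (WithLp.toLp 2 u) (WithLp.toLp 2 b)|) ∧
      K ⟨0, h0⟩ ⟨0, h0⟩ ^ 2 ≤ μ ^ 2 + ((c₂ / c₁ + 1) * (√n * τ)) ^ 2 := by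
  set o : Fin n := ⟨0, by omega⟩ with ho
  set δ := √n * τ with hδ
  have hτ := h.tau_nonneg
  have hδ0 : 0 ≤ δ := by positivity
  have hδn : δ ≤ n * τ := sqrt_mul_le (by omega) hτ
  have hoo := h.diag_pos o
  have hδc : δ ≤ c₂ := by linarith
  have hc₂ : 0 < c₂ := by linarith [show 0 ≤ n * τ by positivity]
  have heig : ∀ i, c₁ ≤ hK.eigenvalues i := fun i =>
    h₁.trans (h.le_eigenvalues hK (by omega) i)
  have hlow : ∀ v, c₁ * l2norm v ≤ l2norm (K.mulVec v) := le_l2norm_mulVec hK hc₁.le heig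
  have hpd : K.PosDef := hK.posDef_iff_eigenvalues_pos.2 fun i => hc₁.trans_le (heig i)
  have hinv : ∀ w, K.mulVec (K⁻¹.mulVec w) = w := fun w => by
    rw [mulVec_mulVec, mul_nonsing_inv _ hpd.det_pos.ne'.isUnit, one_mulVec]
  set z := K⁻¹.mulVec (Pi.single o 1) with hz
  have hKz : K.mulVec z = Pi.single o 1 := hinv _
  have hz0 : 0 < l2norm z := by
    refine lt_of_le_of_ne (l2norm_nonneg z) fun h0 => ?_
    have : z = 0 := by
      have := norm_eq_zero.1 h0.symm
      simpa using this
    rw [this, mulVec_zero] at hKz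
    simpa using congrFun hKz o
  set μ := (l2norm z)⁻¹ with hμ
  have hμ0 : 0 < μ := inv_pos.2 hz0
  set u := μ • z with hu
  have hKu : K.mulVec u = μ • Pi.single o 1 := by rw [hu, mulVec_smul, hKz]
  have hu1 : l2norm u = 1 := by
    rw [hu, l2norm_smul, abs_of_pos hμ0, hμ, inv_mul_cancel₀ hz0.ne']
  -- Pairing with u reads off the coefficient of the first column. Hence w ⊥ u exactly when w
  -- combines the other columns.
  have hud : ∀ c, u ⬝ᵥ K.mulVec c = μ * c o := fun c => by
    rw [dotProduct_mulVec_comm hK, hKu, smul_dotProduct, single_dotProduct]; simp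
  have hucol : ∀ i, u ⬝ᵥ K.col i = μ * (Pi.single o 1 : Fin n → ℝ) i := fun i => by
    rw [dotProduct_comm, col_dotProduct hK, hKu]; simp
  have hcoord : ∀ w, u ⬝ᵥ w = 0 → (K⁻¹.mulVec w) o = 0 := fun w hw => by
    rw [← hinv w, hud] at hw
    exact (mul_eq_zero.1 hw).resolve_left hμ0.ne'
  have hal : IsNearlyAligned (fun i => WithLp.toLp 2 (K.col i)) o (WithLp.toLp 2 u) μ
      ((c₂ / c₁ + 1) * δ) (c₁ ^ 2) (K ⟨1, by omega⟩ ⟨1, by omega⟩ ^ 2 + c₂ * δ) := by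
    refine ⟨hu1, ?_, hμ0, by positivity, fun i hi => ?_, fun v hv => ?_, fun v => ?_,
      fun i hi => ?_⟩
    · rw [inner_toLp, hucol]; simp
    · rw [inner_toLp, hucol, Pi.single_eq_of_ne hi, mul_zero]
    · obtain ⟨w⟩ := v
      rw [inner_toLp] at hv ⊢
      change |_| ≤ _ * l2norm w
      have e0 := hcoord w hv
      set c := K⁻¹.mulVec w with hc
      have hKc : K.mulVec c = w := hinv w
      -- Since c has no first coordinate, w o involves only off-diagonal entries.
      have e1 : |w o| ≤ δ * l2norm c := by
        have := h.abs_row_dotProduct_sub_le o c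
        rw [e0, mul_zero, sub_zero] at this
        rwa [← hKc]
      have e2 : l2norm c ≤ l2norm w / c₁ := by
        rw [le_div_iff₀' hc₁, ← hKc]; exact hlow c
      have e3 : |w o| ≤ δ * (l2norm w / c₁) := e1.trans (mul_le_mul_of_nonneg_left e2 hδ0)
      have e4 := h.abs_row_dotProduct_sub_le o w
      have e5 : K.col o ⬝ᵥ w = K o ⬝ᵥ w := col_dotProduct hK o w
      rw [e5]
      have e6 : |K o ⬝ᵥ w| ≤ |K o ⬝ᵥ w - K o o * w o| + |K o o * w o| := by
        have := abs_add_le (K o ⬝ᵥ w - K o o * w o) (K o o * w o)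
        rwa [sub_add_cancel] at this
      have e7 : |K o o * w o| ≤ c₂ * (δ * (l2norm w / c₁)) := by
        rw [abs_mul, abs_of_pos hoo]
        exact mul_le_mul (by linarith) e3 (abs_nonneg _) hc₂.le
      have e8 : c₂ * (δ * (l2norm w / c₁)) = c₂ / c₁ * δ * l2norm w := by ring
      linarith
    · obtain ⟨w⟩ := v
      change c₁ ^ 2 * l2norm w ^ 2 ≤ _
      rw [← mul_pow]
      refine (pow_le_pow_left₀ (mul_nonneg hc₁.le (l2norm_nonneg w)) (hlow w) 2).trans
        (le_of_eq ?_)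
      rw [l2norm_sq_eq_sum]
      exact Finset.sum_congr rfl fun i _ => by rw [inner_toLp, col_dotProduct hK]
    · change l2norm (K.col i) ^ 2 ≤ _
      refine (h.l2norm_col_sq_le i).trans (add_le_add ?_ ?_)
      · refine pow_le_pow_left₀ (h.diag_pos i).le (h.diag_antitone ?_) 2
        rw [Fin.le_def]
        exact Nat.one_le_iff_ne_zero.2 fun h0 => hi (Fin.ext h0)
      · rw [sq]; exact mul_le_mul_of_nonneg_right hδc hδ0
  refine ⟨u, μ, hal, ?_, fun b => ?_, ?_⟩
  · rw [hKu, l2norm_smul, abs_of_pos hμ0, l2norm]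
    simp
  · have hproj : projFirst K b = (u ⬝ᵥ b) • WithLp.toLp 2 u := by
      rw [projFirst]
      refine Submodule.eq_starProjection_of_mem_orthogonal ?_ ?_
      · refine Submodule.smul_mem _ _ ((Submodule.mem_orthogonal' _ _).2 fun w hw => ?_)
        induction hw using Submodule.span_induction with
        | mem w hw =>
          obtain ⟨j, hj, rfl⟩ := hw
          rw [inner_toLp, hucol, Pi.single_eq_of_ne (fun h0 => hj (by rw [h0])), mul_zero]
        | zero => exact inner_zero_right _
        | add a b _ _ ha hb => rw [inner_add_right, ha, hb, add_zero]
        | smul r a _ ha => rw [inner_smul_right, ha, mul_zero]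
      · refine Submodule.le_orthogonal_orthogonal _ ?_
        set w := b - (u ⬝ᵥ b) • u with hw
        have hw0 : u ⬝ᵥ w = 0 := by
          rw [hw, dotProduct_sub, dotProduct_smul, ← l2norm_sq, hu1]; simp
        have e0 := hcoord w hw0
        have e1 : WithLp.toLp 2 b - (u ⬝ᵥ b) • WithLp.toLp 2 u = WithLp.toLp 2 w := rfl
        have e2 : WithLp.toLp 2 w = ∑ j, (K⁻¹.mulVec w) j • WithLp.toLp 2 (K.col j) := by
          conv_lhs => rw [← hinv w]
          generalize K⁻¹.mulVec w = c
          ext i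
          simp only [mulVec, dotProduct, WithLp.ofLp_sum, WithLp.ofLp_smul,
            Finset.sum_apply, Pi.smul_apply, smul_eq_mul, Matrix.col_apply]
          exact Finset.sum_congr rfl fun j _ => mul_comm _ _
        rw [e1, e2]
        refine Submodule.sum_mem _ fun j _ => ?_
        by_cases hj : j = o
        · rw [hj, e0, zero_smul]; exact Submodule.zero_mem _
        · exact Submodule.smul_mem _ _ (Submodule.subset_span
            ⟨j, fun h0 => hj (Fin.ext h0), rfl⟩)
    rw [hproj, norm_smul, Real.norm_eq_abs, inner_toLp]
    change _ * l2norm u = _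
    rw [hu1, mul_one]
  · have e1 : K o o ^ 2 ≤ l2norm (K.col o) ^ 2 := by
      rw [l2norm_sq_eq_sum]
      exact Finset.single_le_sum (f := fun j => K.col o j ^ 2) (fun j _ => sq_nonneg _)
        (Finset.mem_univ o)
    -- Pythagoras for the first column: its component along u is μ, the rest is at most ω.
    have e2 : l2norm (K.col o) ^ 2 =
        μ ^ 2 + ‖perp (WithLp.toLp 2 u) (WithLp.toLp 2 (K.col o))‖ ^ 2 := by
      rw [perp, norm_sub_sq_real, norm_smul, inner_smul_right,
        real_inner_comm (WithLp.toLp 2 u), hal.inner_eq,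
        hal.norm_eq, Real.norm_eq_abs, mul_one, sq_abs, l2norm]
      ring
    rw [e2] at e1
    have := pow_le_pow_left₀ (norm_nonneg _) hal.norm_perp_le 2
    linarith

end NearlyDiagonal

/-! ### Expected components after both stages. -/

section TwoStage

variable {K : Matrix (Fin n) (Fin n) ℝ}

/-- After the first stage followed by one step of the second stage, the expected component of the
error orthogonal to `u` is an `ε / 4` fraction of the expected component along `u`. -/
theorem sgdExpect_perp_le (hn : 2 ≤ n) (hK : K.IsHermitian) (a α₀ : Fin n → ℝ) {u : Fin n → ℝ}
    {i₀ : Fin n} {μ ω σ M : ℝ}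
    (hal : IsNearlyAligned (fun i => WithLp.toLp 2 (K.col i)) i₀ (WithLp.toLp 2 u) μ ω σ M)
    {η₁ η₂ κ h θ Y ρ ε : ℝ} {k₁ : ℕ} (hη₁ : 0 ≤ η₁) (hη₂ : 0 ≤ η₂)
    (hμ₁ : 2 ≤ η₁ * μ ^ 2) (hM₁ : η₁ * M ≤ 2) (hM₂ : η₂ * M ≤ 2) (hM : 0 ≤ M)
    (hκ : 0 ≤ κ) (hκ' : κ ≤ η₁ / 2 * (σ - ω ^ 2)) (hκ1 : 2 * κ ≤ 1) (hσ : ω ^ 2 ≤ σ)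
    (hh₁ : η₁ * ω * μ ≤ h) (hh₁' : η₁ * ω * ω ≤ h)
    (hh₂ : η₂ * ω * μ ≤ h) (hh₂' : η₂ * ω * ω ≤ h)
    (hY : η₁ * μ ^ 2 - 1 ≤ Y) (hθ : 0 < θ) (hθ1 : θ ≤ 1)
    (hgap : 2 * θ ≤ (η₁ * μ ^ 2 - 2) + κ * (2 - η₁ * M)) (hε : 0 < ε) (hε4 : ε < 1 / 4)
    (hρ : 1 ≤ ρ) (hhr : h * (1 + ε / 16) ≤ θ / 2 * (ε / 16)) (hhρ : h * ρ ≤ θ / 2)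
    (hk₁ : ρ * (1 - θ / (n * Y)) ^ k₁ ≤ ε / 16)
    (hA0 : 0 < |inner ℝ (WithLp.toLp 2 u) (WithLp.toLp 2 (α₀ - a))|)
    (hB0 : ‖WithLp.toLp 2 (α₀ - a)‖ ≤
      ρ * |inner ℝ (WithLp.toLp 2 u) (WithLp.toLp 2 (α₀ - a))|) :
    0 < sgdExpect K (K.mulVec a) (twoStage η₁ η₂ k₁) α₀ (k₁ + 1)
        (fun α => |inner ℝ (WithLp.toLp 2 u) (WithLp.toLp 2 (α - a))|) ∧
      sgdExpect K (K.mulVec a) (twoStage η₁ η₂ k₁) α₀ (k₁ + 1)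
          (fun α => ‖perp (WithLp.toLp 2 u) (WithLp.toLp 2 (α - a))‖) ≤
        ε / 4 * sgdExpect K (K.mulVec a) (twoStage η₁ η₂ k₁) α₀ (k₁ + 1)
          (fun α => |inner ℝ (WithLp.toLp 2 u) (WithLp.toLp 2 (α - a))|) := by
  have hn0 : 0 < n := by omega
  have hn2 : (2 : ℝ) ≤ n := by exact_mod_cast hn
  have hω := hal.omega_nonneg
  have hμ := hal.mu_pos
  have hh : 0 ≤ h := (by positivity : 0 ≤ η₁ * ω * μ).trans hh₁
  set f : (Fin n → ℝ) → ℝ := fun α => |inner ℝ (WithLp.toLp 2 u) (WithLp.toLp 2 (α - a))| with hf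
  set p : (Fin n → ℝ) → ℝ := fun α => ‖perp (WithLp.toLp 2 u) (WithLp.toLp 2 (α - a))‖ with hp
  have hf0 : ∀ α, 0 ≤ f α := fun α => abs_nonneg _
  have hp0 : ∀ α, 0 ≤ p α := fun α => norm_nonneg _
  set A : ℕ → ℝ := fun k => sgdExpect K (K.mulVec a) (twoStage η₁ η₂ k₁) α₀ k f with hA
  set B : ℕ → ℝ := fun k => sgdExpect K (K.mulVec a) (twoStage η₁ η₂ k₁) α₀ k p with hB
  have hAn : ∀ k, 0 ≤ A k := fun k => sgdExpect_nonneg k hf0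
  have hBn : ∀ k, 0 ≤ B k := fun k => sgdExpect_nonneg k hp0
  have hA1 : ∀ t < k₁, (n + (η₁ * μ ^ 2 - 2)) * A t - h * B t ≤ n * A (t + 1) := by
    intro t ht
    have e : (n + (η₁ * μ ^ 2 - 2)) * A t - h * B t =
        (n + (η₁ * μ ^ 2 - 2)) * A t + (-h) * B t := by ring
    rw [e]
    refine le_sgdExpect_succ hn0 t fun α => ?_
    simp only [hf, hp, twoStage, if_pos ht, toLp_sgdStep_sub hK]
    refine le_trans ?_ (hal.le_sum_abs_inner_rankOneStep hη₁ _)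
    rw [Fintype.card_fin]
    have := mul_le_mul_of_nonneg_right hh₁ (hp0 α)
    simp only [hp] at this
    linarith
  have hB1 : ∀ t < k₁, n * B (t + 1) ≤ (n - κ * (2 - η₁ * M)) * B t + h * (A t + B t) := by
    intro t ht
    have e : (n - κ * (2 - η₁ * M)) * B t + h * (A t + B t) =
        (n - κ * (2 - η₁ * M) + h) * B t + h * A t := by ring
    rw [e]
    refine sgdExpect_succ_le hn0 t fun α => ?_
    simp only [hf, hp, twoStage, if_pos ht, toLp_sgdStep_sub hK]
    refine (hal.sum_norm_perp_rankOneStep_le hη₁ hM₁ _).trans ?_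
    rw [Fintype.card_fin]
    have e1 := mul_le_mul_of_nonneg_right hh₁ (hf0 α)
    have e2 := mul_le_mul_of_nonneg_right hh₁' (hp0 α)
    have e3 := mul_le_mul_of_nonneg_right
      (mul_le_mul_of_nonneg_right hκ' (sub_nonneg.2 hM₁)) (hp0 α)
    simp only [hf, hp] at e1 e2 e3
    linarith
  have hA2 : (n - 1) * A k₁ ≤ n * A (k₁ + 1) := by
    have e : ((n : ℝ) - 1) * A k₁ = (n - 1) * A k₁ + 0 * A k₁ := by ring
    rw [e]
    refine le_sgdExpect_succ hn0 k₁ fun α => ?_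
    simp only [hf, twoStage, lt_irrefl, if_false, toLp_sgdStep_sub hK]
    have := hal.le_sum_abs_inner_rankOneStep' η₂ (WithLp.toLp 2 (α - a))
    rw [Fintype.card_fin] at this
    linarith
  have hB2 : n * B (k₁ + 1) ≤ (n + h) * B k₁ + h * A k₁ := by
    refine sgdExpect_succ_le hn0 k₁ fun α => ?_
    simp only [hf, hp, twoStage, lt_irrefl, if_false, toLp_sgdStep_sub hK]
    refine (hal.sum_norm_perp_rankOneStep_le hη₂ hM₂ _).trans ?_
    rw [Fintype.card_fin]
    have e1 := mul_le_mul_of_nonneg_right hh₂ (hf0 α)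
    have e2 := mul_le_mul_of_nonneg_right hh₂' (hp0 α)
    have e3 : 0 ≤ η₂ / 2 * (σ - ω ^ 2) * (2 - η₂ * M) * p α :=
      mul_nonneg (mul_nonneg (mul_nonneg (by positivity) (sub_nonneg.2 hσ))
        (sub_nonneg.2 hM₂)) (hp0 α)
    simp only [hf, hp] at e1 e2 e3
    linarith
  have hA00 : A 0 = f α₀ := sgdExpect_zero _ _ _ _ _
  have hB00 : B 0 ≤ ρ * A 0 := by
    have e1 : B 0 = p α₀ := sgdExpect_zero _ _ _ _ _
    have e2 : p α₀ ^ 2 ≤ ‖WithLp.toLp 2 (α₀ - a)‖ ^ 2 := by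
      simp only [hp, perp]
      rw [norm_sub_sq_real, norm_smul, inner_smul_right, hal.norm_eq,
        real_inner_comm (WithLp.toLp 2 u), mul_one, Real.norm_eq_abs, sq_abs]
      linarith [sq_nonneg (inner ℝ (WithLp.toLp 2 u) (WithLp.toLp 2 (α₀ - a)))]
    rw [e1, hA00]
    exact ((sq_le_sq₀ (hp0 _) (norm_nonneg _)).1 e2).trans hB0
  obtain ⟨hpos, hle⟩ := ratio_le_of_recursion (A := A) (B := B) (k := k₁) (by linarith)
    (q := κ * (2 - η₁ * M)) (s := η₁ * μ ^ 2 - 2) (Y := Y) (r := ε / 16) (ρ := ρ) (h := h)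
    (by have := mul_nonneg hκ (mul_nonneg hη₁ hM); linarith) (by linarith) (by linarith) hθ hθ1
    hgap hh (by linarith) (by linarith) hhr hhρ hA1 hB1 (by rw [hA00]; exact hA0) hB00 k₁ le_rfl
  -- The target ε/16 leaves a factor 4 for the last step: B may reach twice ε/16 times the old A,
  -- and A may halve since (n-1)/n ≥ 1/2.
  rw [max_eq_left hk₁] at hle
  have hpos' : 0 < A (k₁ + 1) := by
    have : 0 < ((n : ℝ) - 1) * A k₁ := mul_pos (by linarith) hpos
    exact pos_of_mul_pos_right (this.trans_le hA2) (by linarith)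
  refine ⟨hpos', ?_⟩
  have hhε : h * (1 + ε / 16) ≤ ε / 16 := by
    have := mul_le_mul_of_nonneg_right hθ1 hε.le
    linarith
  have h1 : A k₁ ≤ 2 * A (k₁ + 1) := by
    have e : 0 ≤ ((n : ℝ) - 2) * A k₁ := mul_nonneg (by linarith) hpos.le
    refine le_of_mul_le_mul_left ?_ (show (0 : ℝ) < n by linarith)
    linarith
  have h2 : B (k₁ + 1) ≤ 2 * (ε / 16) * A k₁ := by
    have e1 : h * B k₁ ≤ h * (ε / 16 * A k₁) := mul_le_mul_of_nonneg_left hle hh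
    have e2 : h * (1 + ε / 16) * A k₁ ≤ ε / 16 * A k₁ :=
      mul_le_mul_of_nonneg_right hhε hpos.le
    have e3 : ε / 16 * A k₁ ≤ n * (ε / 16 * A k₁) :=
      le_mul_of_one_le_left (by positivity) (by linarith)
    have e4 : n * B k₁ ≤ n * (ε / 16 * A k₁) :=
      mul_le_mul_of_nonneg_left hle (by linarith)
    refine le_of_mul_le_mul_left ?_ (show (0 : ℝ) < n by linarith)
    linarith
  have h3 := mul_le_mul_of_nonneg_left h1 (show 0 ≤ 2 * (ε / 16) by positivity)
  change B (k₁ + 1) ≤ ε / 4 * A (k₁ + 1)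
  linarith

end TwoStage

/-! ### From the direction of the error to the estimation error. -/

section Conclusion

variable {X : Type*} {H : Type*} [NormedAddCommGroup H] [InnerProductSpace ℝ H]
  [CompleteSpace H] [RKHS ℝ H X ℝ]

/-- If the expected error is nearly parallel to `u`, and `u` is nearly a top eigenvector, then the
expected estimation error is nearly the best possible. -/
theorem estimationError_of_perp_le (hn : 0 < n) (x : Fin n → X) (fstar : H)
    (hK : (gram H x).PosDef) (y α₀ u : Fin n → ℝ) (η : ℕ → ℝ) (k : ℕ) {ε : ℝ}
    (hε : 0 < ε) (hε4 : ε < 1 / 4) (hu : l2norm u = 1)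
    (hγ : (1 - ε / 4) * gramEig H x ⟨0, hn⟩ ≤ l2norm ((gram H x).mulVec u))
    (hA : 0 < sgdExpect (gram H x) y η α₀ k
        (fun α => |inner ℝ (WithLp.toLp 2 u) (WithLp.toLp 2 (α - alphaHat x fstar))|))
    (hB : sgdExpect (gram H x) y η α₀ k
        (fun α => ‖perp (WithLp.toLp 2 u) (WithLp.toLp 2 (α - alphaHat x fstar))‖) ≤
      ε / 4 * sgdExpect (gram H x) y η α₀ k
        (fun α => |inner ℝ (WithLp.toLp 2 u) (WithLp.toLp 2 (α - alphaHat x fstar))|))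
    (E : ((Fin n → ℝ) → ℝ) → ℝ) (hE : E = sgdExpect (gram H x) y η α₀ k) :
    ((1 - 2 * ε) * gramEig H x ⟨0, hn⟩ ≤
        E (fun α => l2norm ((gram H x).mulVec (α - alphaHat x fstar))) /
          E (fun α => l2norm (α - alphaHat x fstar)) ∧
      E (fun α => l2norm ((gram H x).mulVec (α - alphaHat x fstar))) /
          E (fun α => l2norm (α - alphaHat x fstar)) ≤ gramEig H x ⟨0, hn⟩) ∧
    ∀ a : ℝ, E (fun α => l2norm (residual x fstar α)) ^ 2 = 2 * n * a →
      E (fun α => √(estimationError x fstar (estimator H x α))) ≤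
        (1 + 4 * ε) * √(bestError x fstar a) := by
  rw [← hE] at hA hB
  have hn' : (0 : ℝ) < n := by exact_mod_cast hn
  have hH := gram_isHermitian H x
  have hγ0 := gramEig_pos x hK ⟨0, hn⟩
  have hmax := eigenvalues_le_gramEig (H := H) x hn
  have hnn := fun i => (hK.eigenvalues_pos i).le
  have hbest := fun (a : ℝ) (ha : 0 ≤ a) => bestError_eq x fstar hK hn (a := a) ha
  set γ := gramEig H x ⟨0, hn⟩ with hγdef
  set â := alphaHat x fstar with hâ
  set f : (Fin n → ℝ) → ℝ := fun α => |inner ℝ (WithLp.toLp 2 u) (WithLp.toLp 2 (α - â))| with hf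
  set p : (Fin n → ℝ) → ℝ := fun α => ‖perp (WithLp.toLp 2 u) (WithLp.toLp 2 (α - â))‖ with hp
  have hmono : ∀ {F G : (Fin n → ℝ) → ℝ}, (∀ α, F α ≤ G α) → E F ≤ E G := by
    intro F G h; rw [hE]; exact sgdExpect_mono k h
  have hlin : ∀ (F G : (Fin n → ℝ) → ℝ) (c d : ℝ),
      E (fun α => c * F α + d * G α) = c * E F + d * E G := by
    intro F G c d; rw [hE]; exact sgdExpect_lin k F G c d
  set P := E (fun α => l2norm ((gram H x).mulVec (α - â))) with hP
  set Q := E (fun α => l2norm (α - â)) with hQ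
  have hperp : ∀ b : Fin n → ℝ, perp (WithLp.toLp 2 u) (WithLp.toLp 2 b) =
      WithLp.toLp 2 (b - (inner ℝ (WithLp.toLp 2 u) (WithLp.toLp 2 b) : ℝ) • u) := by
    intro b; rw [perp, WithLp.toLp_sub, WithLp.toLp_smul]
  have hP1 : l2norm ((gram H x).mulVec u) * E f + (-γ) * E p ≤ P := by
    rw [← hlin]
    refine hmono fun α => ?_
    simp only [hf, hp]
    rw [hperp]
    set b := α - â
    set c : ℝ := inner ℝ (WithLp.toLp 2 u) (WithLp.toLp 2 b)
    have e1 : (gram H x).mulVec (c • u) = (gram H x).mulVec b - (gram H x).mulVec (b - c • u) := by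
      rw [mulVec_sub _ b, sub_sub_cancel]
    have e2 : l2norm ((gram H x).mulVec (c • u)) ≤
        l2norm ((gram H x).mulVec b) + l2norm ((gram H x).mulVec (b - c • u)) := by
      rw [e1]; exact norm_sub_le (WithLp.toLp 2 _) (WithLp.toLp 2 _)
    have e3 := l2norm_mulVec_le hH hγ0.le hnn hmax (b - c • u)
    rw [mulVec_smul, l2norm_smul] at e2
    change _ + -γ * l2norm _ ≤ _
    linarith
  have hQ1 : Q ≤ 1 * E f + 1 * E p := by
    rw [← hlin]
    refine hmono fun α => ?_
    simp only [hf, hp]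
    have e : WithLp.toLp 2 (α - â) = (inner ℝ (WithLp.toLp 2 u) (WithLp.toLp 2 (α - â)) : ℝ) •
        WithLp.toLp 2 u + perp (WithLp.toLp 2 u) (WithLp.toLp 2 (α - â)) := by
      rw [perp]; abel
    have e2 : ‖WithLp.toLp 2 u‖ = 1 := hu
    calc l2norm (α - â) = ‖WithLp.toLp 2 (α - â)‖ := rfl
      _ ≤ _ := by
        nth_rewrite 1 [e]
        refine (norm_add_le _ _).trans ?_
        rw [norm_smul, e2, Real.norm_eq_abs]
        linarith
  have hPQ : P ≤ γ * Q + 0 * Q := by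
    rw [← hlin]
    refine hmono fun α => ?_
    have := l2norm_mulVec_le hH hγ0.le hnn hmax (α - â)
    linarith
  -- Here P ≥ (1 - ε/2)γ E f and Q ≤ (1 + ε/4) E f, with slack 5ε/4 + ε²/2.
  have hlow : (1 - 2 * ε) * γ * Q ≤ P := by
    have e1 := mul_le_mul_of_nonneg_right hγ hA.le
    have e2 := mul_le_mul_of_nonneg_left hB hγ0.le
    have e3 : (1 - 2 * ε) * γ * Q ≤ (1 - 2 * ε) * γ * (E f + ε / 4 * E f) :=
      mul_le_mul_of_nonneg_left (by linarith) (mul_nonneg (by linarith) hγ0.le)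
    have e4 : 0 ≤ γ * E f * (5 * ε / 4 + ε ^ 2 / 2) := by positivity
    linarith
  have hQ0 : 0 < Q := by
    have e1 := mul_le_mul_of_nonneg_right hγ hA.le
    have e2 := mul_le_mul_of_nonneg_left hB hγ0.le
    have e3 : 0 < γ * E f * (1 - ε / 2) := mul_pos (mul_pos hγ0 hA) (by linarith)
    have e4 : 0 < γ * Q := by linarith
    exact pos_of_mul_pos_right e4 hγ0.le
  refine ⟨⟨(le_div_iff₀ hQ0).2 hlow, (div_le_iff₀ hQ0).2 (by linarith)⟩, fun a ha => ?_⟩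
  have hres : E (fun α => l2norm (residual x fstar α)) = P := by
    simp only [residual_eq_mulVec x fstar hK, hP, hâ]
  rw [hres] at ha
  have ha0 : 0 ≤ a := by
    have : 0 ≤ 2 * (n : ℝ) * a := ha ▸ sq_nonneg P
    exact nonneg_of_mul_nonneg_right this (by positivity)
  have hP0 : 0 ≤ P := le_trans (mul_nonneg (mul_nonneg (by linarith) hγ0.le) hQ0.le) hlow
  rw [hbest a ha0, ← ha, Real.sqrt_div (sq_nonneg P), Real.sqrt_sq hP0]
  have hS : E (fun α => √(estimationError x fstar (estimator H x α))) ≤ √γ * Q + 0 * Q := by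
    rw [← hlin]
    refine hmono fun α => ?_
    rw [estimationError_estimator x fstar hK, zero_mul, add_zero]
    refine Real.sqrt_le_iff.2 ⟨mul_nonneg (Real.sqrt_nonneg _) (l2norm_nonneg _), ?_⟩
    rw [mul_pow, Real.sq_sqrt hγ0.le]
    exact quadForm_le hH hmax _
  refine hS.trans ?_
  have hs : 0 < √γ := Real.sqrt_pos.2 hγ0
  rw [← mul_div_assoc, le_div_iff₀ hs, zero_mul, add_zero]
  have e1 : √γ * Q * √γ = γ * Q := by
    rw [mul_right_comm, Real.mul_self_sqrt hγ0.le]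
  rw [e1]
  have e2 := mul_le_mul_of_nonneg_left hlow (show 0 ≤ 1 + 4 * ε by linarith)
  -- This is (1 + 4ε)(1 - 2ε) ≥ 1, the reason for requiring ε < 1/4.
  have e3 : 0 ≤ γ * Q * (2 * ε * (1 - 4 * ε)) :=
    mul_nonneg (by positivity) (mul_nonneg (by linarith) (by linarith))
  linarith

end Conclusion

/-! ### A constant meeting finitely many linear constraints. -/

section StepSizes

theorem exists_pos_mul_le {ι : Type*} [Fintype ι] (a b : ι → ℝ) (hb : ∀ i, 0 < b i) :
    ∃ c : ℝ, 0 < c ∧ ∀ i, a i * c ≤ b i := by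
  have hS : 0 ≤ ∑ i, |a i| / b i :=
    Finset.sum_nonneg fun i _ => div_nonneg (abs_nonneg _) (hb i).le
  refine ⟨1 / (1 + ∑ i, |a i| / b i), by positivity, fun i => ?_⟩
  rw [mul_one_div, div_le_iff₀ (by positivity)]
  have h1 : |a i| / b i ≤ ∑ i, |a i| / b i :=
    Finset.single_le_sum (f := fun i => |a i| / b i)
      (fun i _ => div_nonneg (abs_nonneg _) (hb i).le) (Finset.mem_univ i)
  rw [div_le_iff₀ (hb i)] at h1
  linarith [le_abs_self (a i), hb i]

end StepSizes

/-! ### The SGD bound with explicit constants. -/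

section TwoStage

variable {X : Type*} {H : Type*} [NormedAddCommGroup H] [InnerProductSpace ℝ H]
  [CompleteSpace H] [RKHS ℝ H X ℝ]

/-- With δ = √n τ, the roles are: ω = Wδ is the misalignment, κ the contraction constant, 2θ the
gap, ρ the initial ratio bound, nY the growth bound, h₀δ the cross terms, and cε the bound on nτ. -/
theorem sgd_estimationError {c₁ c₂ g β₀ R W κ θ ρ Y h₀ c : ℝ} (hc₁ : 0 < c₁) (hc₂ : 0 < c₂)
    (hg : 0 < g) (hβ₀ : 0 < β₀) (hR : 0 < R)
    (hW : W = c₂ / c₁ + 1) (hκ : κ = c₁ ^ 2 / (2 * c₂ ^ 2)) (hθ : θ = κ * g / (2 * c₂ ^ 2))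
    (hρ : ρ = R / β₀ + 1) (hY : Y = 1 + 2 * c₂ ^ 2 / c₁ ^ 2)
    (hh₀ : h₀ = 2 / c₁ ^ 2 * (c₂ * W + c₂ * W ^ 2)) (hc : 0 < c)
    (hcg : W ^ 2 * c₂ * c ≤ g) (hcg' : c₂ * c ≤ g)
    (hch : 64 * h₀ * c ≤ θ) (hchρ : 2 * h₀ * ρ * c ≤ θ) (hcW : 4 * (W + 1) * c ≤ c₁)
    (hn : 2 ≤ n) (h0 : 0 < n) (h1 : 1 < n) (hl : n - 1 < n) (x : Fin n → X) (fstar : H) (α₀ : Fin n → ℝ) (τ η₁ η₂ ε : ℝ)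
    (hτ : HasSmallOffDiag (gram H x) τ)
    (h₁ : c₁ ≤ gram H x ⟨n - 1, hl⟩ ⟨n - 1, hl⟩ - n * τ)
    (h₂ : gram H x ⟨0, h0⟩ ⟨0, h0⟩ + n * τ ≤ c₂)
    (hgap : gram H x ⟨1, h1⟩ ⟨1, h1⟩ ^ 2 + g ≤
        gram H x ⟨0, h0⟩ ⟨0, h0⟩ ^ 2)
    (hproj : β₀ ≤ ‖projFirst (gram H x) (α₀ - alphaHat x fstar)‖)
    (hnorm : l2norm (α₀ - alphaHat x fstar) ≤ R)
    (hη₁ : 2 / (gram H x ⟨0, h0⟩ ⟨0, h0⟩ ^ 2 - W ^ 2 * c₂ * √n * τ) < η₁)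
    (hη₁' : η₁ < 2 / (gram H x ⟨1, h1⟩ ⟨1, h1⟩ ^ 2 + c₂ * √n * τ))
    (hη₂ : 0 < η₂)
    (hη₂' : η₂ < 1 / (gram H x ⟨0, h0⟩ ⟨0, h0⟩ ^ 2 + c₂ * √n * τ))
    (hε : 0 < ε) (hε4 : ε < 1 / 4) (hτε : n * τ < c * ε) :
    ∃ k₁ k₂ : ℕ, 1 ≤ k₁ ∧
      (k₁ : ℝ) ≤ (n * Y / θ * (Real.log (16 * ρ) + 1) + 2) * Real.log (1 / ε) ∧ k₁ < k₂ ∧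
      ∀ E : ((Fin n → ℝ) → ℝ) → ℝ,
      E = sgdExpect (gram H x) (labels x fstar) (twoStage η₁ η₂ k₁) α₀ k₂ →
      ((1 - 2 * ε) * gramEig H x ⟨0, h0⟩ ≤
          E (fun α => l2norm ((gram H x).mulVec (α - alphaHat x fstar))) /
            E (fun α => l2norm (α - alphaHat x fstar)) ∧
        E (fun α => l2norm ((gram H x).mulVec (α - alphaHat x fstar))) /
            E (fun α => l2norm (α - alphaHat x fstar)) ≤ gramEig H x ⟨0, h0⟩) ∧
      ∀ a : ℝ, E (fun α => l2norm (residual x fstar α)) ^ 2 = 2 * n * a →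
        E (fun α => √(estimationError x fstar (estimator H x α))) ≤
          (1 + 4 * ε) * √(bestError x fstar a) := by
  have hH := gram_isHermitian H x
  have heig := fun i => h₁.trans (hτ.le_eigenvalues hH (by omega) i)
  have hmax := fun i => (hτ.eigenvalues_le hH (by omega) i).trans h₂
  have hpd : (gram H x).PosDef := hH.posDef_iff_eigenvalues_pos.2 fun i => hc₁.trans_le (heig i)
  obtain ⟨u, μ, hal, hμK, hpr, hμ2⟩ := exists_isNearlyAligned hn h0 h1 hl hH hτ hc₁ h₁ h₂
  rw [← hW] at hal hμ2
  have hu : l2norm u = 1 := hal.norm_eq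
  have hμ0 := hal.mu_pos
  have hτ0 := hτ.tau_nonneg
  have hl₀ := hτ.diag_pos ⟨0, by omega⟩
  have hl₁ := hτ.diag_pos ⟨1, by omega⟩
  have hl₁' : c₁ ≤ gram H x ⟨1, by omega⟩ ⟨1, by omega⟩ := by
    have e1 : gram H x ⟨n - 1, by omega⟩ ⟨n - 1, by omega⟩ ≤
        gram H x ⟨1, by omega⟩ ⟨1, by omega⟩ :=
      hτ.diag_antitone (by rw [Fin.le_def]; simp only; omega)
    have : 0 ≤ n * τ := by positivity
    linarith
  have hγ₀ : gramEig H x ⟨0, by omega⟩ ≤ gram H x ⟨0, by omega⟩ ⟨0, by omega⟩ + n * τ := by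
    obtain ⟨i, hi⟩ := gramEig_eq (H := H) x ⟨0, by omega⟩
    rw [← hi]
    exact hτ.eigenvalues_le hH (by omega) i
  have hγc : c₁ ≤ gramEig H x ⟨0, by omega⟩ := by
    obtain ⟨i, hi⟩ := gramEig_eq (H := H) x ⟨0, by omega⟩
    rw [← hi]
    exact heig i
  rw [mul_assoc (W ^ 2 * c₂)] at hη₁
  rw [mul_assoc c₂] at hη₁' hη₂'
  have hδn : √n * τ ≤ n * τ := sqrt_mul_le (by omega) hτ0
  have hδ0 : 0 ≤ √n * τ := by positivity
  have hμc : μ ≤ c₂ := by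
    have := l2norm_mulVec_le hH hc₂.le (fun i => hc₁.le.trans (heig i)) hmax u
    rwa [hμK, hu, mul_one] at this
  set l₀ := gram H x ⟨0, by omega⟩ ⟨0, by omega⟩ with hl₀def
  set l₁ := gram H x ⟨1, by omega⟩ ⟨1, by omega⟩ with hl₁def
  set δ := √n * τ with hδ
  have hl₀c : l₀ ≤ c₂ := by linarith
  have hδc : δ ≤ c₂ := by linarith
  have hc₁₂ : c₁ ≤ c₂ := hl₁'.trans (by
    have : l₁ ^ 2 ≤ l₀ ^ 2 := by linarith
    exact ((sq_le_sq₀ hl₁.le hl₀.le).1 this).trans hl₀c)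
  have hδε : δ ≤ c * ε := by linarith
  have hδ4 : δ ≤ c / 4 := by
    have := mul_le_mul_of_nonneg_left hε4.le hc.le
    linarith
  have hW1 : 1 ≤ W := by rw [hW]; have := div_pos hc₂ hc₁; linarith
  have hW0 : 0 < W := by linarith
  have hh₀0 : 0 < h₀ := by rw [hh₀]; positivity
  have hκ0 : 0 < κ := by rw [hκ]; positivity
  have hθ0 : 0 < θ := by rw [hθ]; positivity
  have hρ1 : 1 ≤ ρ := by rw [hρ]; have := div_pos hR hβ₀; linarith
  have hl₀sq : l₀ ^ 2 ≤ c₂ ^ 2 := pow_le_pow_left₀ hl₀.le hl₀c 2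
  have hl₁sq : c₁ ^ 2 ≤ l₁ ^ 2 := pow_le_pow_left₀ hc₁.le hl₁' 2
  have hκ1 : 2 * κ ≤ 1 := by
    rw [hκ, ← mul_div_assoc, div_le_one (by positivity)]
    linarith
  have hθ1 : θ ≤ 1 := by
    rw [hθ, div_le_one (by positivity)]
    have : κ * g ≤ 1 * g := mul_le_mul_of_nonneg_right (by linarith) hg.le
    linarith [sq_nonneg l₁]
  have hωg : W ^ 2 * c₂ * δ ≤ g / 4 := by
    have := mul_le_mul_of_nonneg_left hδ4 (show 0 ≤ W ^ 2 * c₂ by positivity)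
    linarith
  have hcδ : c₂ * δ ≤ g / 4 := by
    have := mul_le_mul_of_nonneg_left hδ4 hc₂.le
    linarith
  have hωδ : (W * δ) ^ 2 ≤ W ^ 2 * c₂ * δ := by
    have := mul_le_mul_of_nonneg_left hδc (show 0 ≤ W ^ 2 * δ by positivity)
    linarith
  have hωc : W * δ ≤ c₁ / 2 := by
    have := mul_le_mul_of_nonneg_left hδ4 hW0.le
    linarith
  have hωc2 : (W * δ) ^ 2 ≤ c₁ ^ 2 / 2 := by
    have := pow_le_pow_left₀ (by positivity) hωc 2
    linarith [sq_nonneg c₁]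
  -- consequences of the step size bounds
  have hden : 0 < l₀ ^ 2 - W ^ 2 * c₂ * δ := by linarith [sq_nonneg l₁]
  have hη₁0 : 0 < η₁ := (div_pos two_pos hden).trans hη₁
  rw [div_lt_iff₀ hden] at hη₁
  rw [lt_div_iff₀ (by positivity)] at hη₁' hη₂'
  -- The choice C₁ = W²c₂ makes C₁δ ≥ ω², so λ₁² - C₁δ ≤ μ².
  have hμη : 2 ≤ η₁ * μ ^ 2 :=
    hη₁.le.trans (mul_le_mul_of_nonneg_left (by linarith) hη₁0.le)
  have hη₁low : 2 ≤ η₁ * c₂ ^ 2 :=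
    hη₁.le.trans (mul_le_mul_of_nonneg_left
      (by linarith [show 0 ≤ W ^ 2 * c₂ * δ by positivity]) hη₁0.le)
  have hη₁up : η₁ ≤ 2 / c₁ ^ 2 := by
    rw [le_div_iff₀ (by positivity)]
    exact (mul_le_mul_of_nonneg_left (by linarith [show 0 ≤ c₂ * δ by positivity])
      hη₁0.le).trans hη₁'.le
  have hη₂M : η₂ * (l₁ ^ 2 + c₂ * δ) ≤ 1 :=
    (mul_le_mul_of_nonneg_left (by linarith) hη₂.le).trans hη₂'.le
  have hη₂up : η₂ ≤ 2 / c₁ ^ 2 := by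
    rw [le_div_iff₀ (by positivity)]
    have := mul_le_mul_of_nonneg_left (show c₁ ^ 2 ≤ l₁ ^ 2 + c₂ * δ by
      linarith [show 0 ≤ c₂ * δ by positivity]) hη₂.le
    linarith
  have hcross : ∀ η, 0 ≤ η → η ≤ 2 / c₁ ^ 2 →
      η * (W * δ) * μ ≤ h₀ * δ ∧ η * (W * δ) * (W * δ) ≤ h₀ * δ := by
    intro η hη hη'
    have e1 : η * (W * δ * μ) ≤ 2 / c₁ ^ 2 * (W * δ * c₂) :=
      mul_le_mul hη' (mul_le_mul_of_nonneg_left hμc (by positivity)) (by positivity)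
        (by positivity)
    have e2 : η * (W * δ) ^ 2 ≤ 2 / c₁ ^ 2 * (W ^ 2 * c₂ * δ) :=
      mul_le_mul hη' hωδ (by positivity) (by positivity)
    have e3 : h₀ * δ = 2 / c₁ ^ 2 * (W * δ * c₂) + 2 / c₁ ^ 2 * (W ^ 2 * c₂ * δ) := by
      rw [hh₀]; ring
    have e4 : 0 ≤ 2 / c₁ ^ 2 * (W * δ * c₂) := by positivity
    have e5 : 0 ≤ 2 / c₁ ^ 2 * (W ^ 2 * c₂ * δ) := by positivity
    exact ⟨by linarith, by linarith⟩
  have hκη : κ ≤ η₁ / 2 * (c₁ ^ 2 - (W * δ) ^ 2) := by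
    have e1 : κ * (2 * c₂ ^ 2) = c₁ ^ 2 := by rw [hκ]; field_simp
    have e2 : η₁ / 2 * (c₁ ^ 2 / 2) ≤ η₁ / 2 * (c₁ ^ 2 - (W * δ) ^ 2) :=
      mul_le_mul_of_nonneg_left (by linarith) (by positivity)
    have e3 : 2 * κ ≤ η₁ * c₂ ^ 2 * κ := mul_le_mul_of_nonneg_right hη₁low hκ0.le
    have e4 : η₁ / 2 * (c₁ ^ 2 / 2) = η₁ * c₂ ^ 2 * κ / 2 := by rw [← e1]; ring
    linarith
  -- Growth and contraction may each be arbitrarily small, but as κ ≤ 1 their sum is at least κη₁(μ²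
  -- - M), where the 2's cancel. This is at least κη₁g/2, uniformly in the admissible η₁.
  have hθgap : 2 * θ ≤ (η₁ * μ ^ 2 - 2) + κ * (2 - η₁ * (l₁ ^ 2 + c₂ * δ)) := by
    have e1 : κ * (η₁ * μ ^ 2 - 2) ≤ 1 * (η₁ * μ ^ 2 - 2) :=
      mul_le_mul_of_nonneg_right (by linarith) (by linarith)
    have e2 : η₁ * (g / 2) ≤ η₁ * (μ ^ 2 - (l₁ ^ 2 + c₂ * δ)) :=
      mul_le_mul_of_nonneg_left (by linarith) hη₁0.le
    have e3 : 2 / c₂ ^ 2 ≤ η₁ := (div_le_iff₀ (by positivity)).2 hη₁low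
    have e4 : 2 / c₂ ^ 2 * (g / 2) ≤ η₁ * (g / 2) :=
      mul_le_mul_of_nonneg_right e3 (by positivity)
    have e5 := mul_le_mul_of_nonneg_left (e4.trans e2) hκ0.le
    have e6 : 2 * θ = κ * (2 / c₂ ^ 2 * (g / 2)) := by rw [hθ]; field_simp
    linarith
  have hYμ : η₁ * μ ^ 2 - 1 ≤ Y := by
    have e1 : η₁ * μ ^ 2 ≤ 2 / c₁ ^ 2 * c₂ ^ 2 :=
      mul_le_mul hη₁up (pow_le_pow_left₀ hμ0.le hμc 2) (by positivity) (by positivity)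
    rw [hY, mul_div_right_comm]
    linarith
  have hY1 : 1 ≤ Y := by rw [hY]; linarith [show 0 ≤ 2 * c₂ ^ 2 / c₁ ^ 2 by positivity]
  have hn1 : (1 : ℝ) ≤ n := by exact_mod_cast (by omega : 1 ≤ n)
  have hh₀δ : h₀ * δ ≤ h₀ * c * ε := by
    have := mul_le_mul_of_nonneg_left hδε hh₀0.le
    linarith
  have hhr : h₀ * δ * (1 + ε / 16) ≤ θ / 2 * (ε / 16) := by
    have e1 : h₀ * δ * (1 + ε / 16) ≤ h₀ * c * ε * 2 :=
      mul_le_mul hh₀δ (by linarith) (by positivity) (by positivity)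
    have e2 := mul_le_mul_of_nonneg_right hch hε.le
    linarith
  have hhρ : h₀ * δ * ρ ≤ θ / 2 := by
    have e1 : h₀ * δ * ρ ≤ h₀ * (c / 4) * ρ :=
      mul_le_mul_of_nonneg_right (mul_le_mul_of_nonneg_left hδ4 hh₀0.le) (by linarith)
    linarith
  obtain ⟨k₁, hk1, hkD, hkρ⟩ := exists_steps hθ0
    (hθ1.trans (one_le_mul_of_one_le_of_one_le hn1 hY1)) hρ1 hε hε4
  -- A single step of the second stage is enough.
  refine ⟨k₁, k₁ + 1, hk1, hkD, Nat.lt_succ_self k₁, ?_⟩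
  rw [hpr] at hproj
  obtain ⟨hA, hB⟩ := sgdExpect_perp_le hn hH (alphaHat x fstar) α₀ hal hη₁0.le hη₂.le hμη
    hη₁'.le (by linarith) (by positivity) hκ0.le hκη hκ1 (by linarith [sq_nonneg c₁])
    (hcross η₁ hη₁0.le hη₁up).1 (hcross η₁ hη₁0.le hη₁up).2
    (hcross η₂ hη₂.le hη₂up).1 (hcross η₂ hη₂.le hη₂up).2 hYμ hθ0 hθ1 hθgap hε hε4 hρ1 hhr hhρ
    hkρ (hβ₀.trans_le hproj) (by
      have e1 : R ≤ ρ * β₀ := by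
        rw [hρ, add_mul, div_mul_cancel₀ _ hβ₀.ne']; linarith
      exact hnorm.trans (e1.trans (mul_le_mul_of_nonneg_left hproj (by linarith))))
  rw [gram_mulVec_alphaHat x fstar hpd] at hA hB
  refine estimationError_of_perp_le (by omega) x fstar hpd _ _ u _ _ hε hε4 hu ?_ hA hB
  rw [hμK]
  have hlμ : l₀ ≤ μ + W * δ := by
    refine (sq_le_sq₀ hl₀.le (by positivity)).1 (hμ2.trans ?_)
    linarith [show 0 ≤ 2 * μ * (W * δ) by positivity, add_sq μ (W * δ)]
  -- In total γ₁ ≤ λ₁ + nτ ≤ μ + (W + 1)cε ≤ μ + c₁ε/4, and c₁ ≤ γ₁.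
  have e1 : W * δ ≤ W * (c * ε) := mul_le_mul_of_nonneg_left hδε hW0.le
  have e2 := mul_le_mul_of_nonneg_right hcW hε.le
  have e3 := mul_le_mul_of_nonneg_right hγc hε.le
  linarith

end TwoStage

end KernelSGD

end


theorem theorem4 :
    -- the estimation error, and its minimum on the level sets of the training loss
    (∀ (n : ℕ) (hn : 1 ≤ n) (X : Type u) (H : Type v) [NormedAddCommGroup H]
      [InnerProductSpace ℝ H] [CompleteSpace H] [RKHS ℝ H X ℝ] (x : Fin n → X) (fstar : H),
      (gram H x).PosDef →
        (∀ α : Fin n → ℝ, estimationError x fstar (estimator H x α) =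
          (α - alphaHat x fstar) ⬝ᵥ (gram H x).mulVec (α - alphaHat x fstar)) ∧
        ∀ a : ℝ, 0 ≤ a →
          bestError x fstar a = 2 * n * a / gramEig H x ⟨0, by omega⟩ ∧
          IsLeast (estimationError x fstar '' levelSet x fstar a)
            (2 * n * a / gramEig H x ⟨0, by omega⟩)) ∧
    -- two-stage SGD
    (∀ c₁ c₂ : ℝ, 0 < c₁ → 0 < c₂ →
      ∃ C₁ C₂ C₃ : ℝ, 0 < C₁ ∧ 0 < C₂ ∧ 0 < C₃ ∧
      ∀ g β₀ R : ℝ, 0 < g → 0 < β₀ → 0 < R →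
      ∃ p : Polynomial ℝ, (∀ e : ℝ, 0 < e → 0 < p.eval e) ∧
      ∀ (n : ℕ) (hn : 2 ≤ n),
      ∃ D : ℝ,
      ∀ (X : Type u) (H : Type v) [NormedAddCommGroup H] [InnerProductSpace ℝ H]
        [CompleteSpace H] [RKHS ℝ H X ℝ] (x : Fin n → X) (fstar : H)
        (α₀ : Fin n → ℝ) (τ η₁ η₂ ε : ℝ),
      HasSmallOffDiag (gram H x) τ →
      c₁ ≤ gram H x ⟨n - 1, by omega⟩ ⟨n - 1, by omega⟩ - n * τ →
      gram H x ⟨0, by omega⟩ ⟨0, by omega⟩ + n * τ ≤ c₂ →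
      gram H x ⟨1, by omega⟩ ⟨1, by omega⟩ ^ 2 + g ≤
        gram H x ⟨0, by omega⟩ ⟨0, by omega⟩ ^ 2 →
      β₀ ≤ ‖projFirst (gram H x) (α₀ - alphaHat x fstar)‖ →
      l2norm (α₀ - alphaHat x fstar) ≤ R →
      2 / (gram H x ⟨0, by omega⟩ ⟨0, by omega⟩ ^ 2 - C₁ * √n * τ) < η₁ →
      η₁ < 2 / (gram H x ⟨1, by omega⟩ ⟨1, by omega⟩ ^ 2 + C₂ * √n * τ) →
      0 < η₂ →
      η₂ < 1 / (gram H x ⟨0, by omega⟩ ⟨0, by omega⟩ ^ 2 + C₃ * √n * τ) →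
      0 < ε → ε < 1 / 4 → n * τ < p.eval ε →
      ∃ k₁ k₂ : ℕ, 1 ≤ k₁ ∧ (k₁ : ℝ) ≤ D * Real.log (1 / ε) ∧ k₁ < k₂ ∧
        ∀ E : ((Fin n → ℝ) → ℝ) → ℝ,
        E = sgdExpect (gram H x) (labels x fstar) (twoStage η₁ η₂ k₁) α₀ k₂ →
        ((1 - 2 * ε) * gramEig H x ⟨0, by omega⟩ ≤
            E (fun α => l2norm ((gram H x).mulVec (α - alphaHat x fstar))) /
              E (fun α => l2norm (α - alphaHat x fstar)) ∧
          E (fun α => l2norm ((gram H x).mulVec (α - alphaHat x fstar))) /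
              E (fun α => l2norm (α - alphaHat x fstar)) ≤ gramEig H x ⟨0, by omega⟩) ∧
        ∀ a : ℝ, E (fun α => l2norm (residual x fstar α)) ^ 2 = 2 * n * a →
          E (fun α => √(estimationError x fstar (estimator H x α))) ≤
            (1 + 4 * ε) * √(bestError x fstar a)) ∧
    -- GD
    (∀ (n : ℕ) (hn : 1 ≤ n) (X : Type u) (H : Type v) [NormedAddCommGroup H]
      [InnerProductSpace ℝ H] [CompleteSpace H] [RKHS ℝ H X ℝ] (x : Fin n → X) (fstar : H)
      (α₀ : Fin n → ℝ) (τ η : ℝ),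
      (gram H x).PosDef → HasSmallOffDiag (gram H x) τ →
      0 < η → η < n / (gram H x ⟨0, by omega⟩ ⟨0, by omega⟩ + n * τ) ^ 2 →
      (∃ v : Fin n → ℝ, (gram H x).mulVec v = gramEig H x ⟨n - 1, by omega⟩ • v ∧
        v ⬝ᵥ (α₀ - alphaHat x fstar) ≠ 0) →
      ∃ D : ℝ, ∀ ε' : ℝ, 0 < ε' →
        ε' < 1 - gramEig H x ⟨n - 1, by omega⟩ / gramEig H x ⟨0, by omega⟩ →
        ∀ k : ℕ, D * Real.log (1 / ε') ≤ k →
        ∀ α : Fin n → ℝ, α = gdIterate (gram H x) (labels x fstar) η α₀ k →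
        (gramEig H x ⟨n - 1, by omega⟩ ≤
            l2norm ((gram H x).mulVec (α - alphaHat x fstar)) / l2norm (α - alphaHat x fstar) ∧
          l2norm ((gram H x).mulVec (α - alphaHat x fstar)) / l2norm (α - alphaHat x fstar) ≤
            √(1 + ε') * gramEig H x ⟨n - 1, by omega⟩) ∧
        1 < gramEig H x ⟨0, by omega⟩ / gramEig H x ⟨n - 1, by omega⟩ * (1 - ε') ∧
        gramEig H x ⟨0, by omega⟩ / gramEig H x ⟨n - 1, by omega⟩ * (1 - ε') *
            bestError x fstar (trainingLoss x fstar α) ≤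
          estimationError x fstar (estimator H x α)) := by
  refine ⟨fun n hn X H _ _ _ _ x fstar hK => ⟨estimationError_estimator x fstar hK,
    fun a ha => ⟨bestError_eq x fstar hK hn ha, isLeast_estimationError x fstar hK hn ha⟩⟩,
    fun c₁ c₂ hc₁ hc₂ => ?_, fun n hn X H _ _ _ _ x fstar α₀ τ η hK hτ hη hη' hv =>
      gd_estimationError (by omega) (by omega) x fstar α₀ τ η hK hτ hη hη' hv⟩
  have hW : 0 < c₂ / c₁ + 1 := by positivity
  refine ⟨(c₂ / c₁ + 1) ^ 2 * c₂, c₂, c₂, by positivity, hc₂, hc₂,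
    fun g β₀ R hg hβ₀ hR => ?_⟩
  obtain ⟨W, hWdef⟩ : ∃ W, W = c₂ / c₁ + 1 := ⟨_, rfl⟩
  obtain ⟨κ, hκ⟩ : ∃ κ, κ = c₁ ^ 2 / (2 * c₂ ^ 2) := ⟨_, rfl⟩
  obtain ⟨θ, hθ⟩ : ∃ θ, θ = κ * g / (2 * c₂ ^ 2) := ⟨_, rfl⟩
  obtain ⟨ρ, hρ⟩ : ∃ ρ, ρ = R / β₀ + 1 := ⟨_, rfl⟩
  obtain ⟨Y, hY⟩ : ∃ Y, Y = 1 + 2 * c₂ ^ 2 / c₁ ^ 2 := ⟨_, rfl⟩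
  obtain ⟨h₀, hh₀⟩ : ∃ h₀, h₀ = 2 / c₁ ^ 2 * (c₂ * W + c₂ * W ^ 2) := ⟨_, rfl⟩
  have hθ0 : 0 < θ := by rw [hθ, hκ]; positivity
  -- The constraints keep the perturbations of λ₁² and λ₂² below the gap g, then the cross terms
  -- below θ, and finally μ close to γ₁.
  obtain ⟨c, hc, hcle⟩ := exists_pos_mul_le
    ![W ^ 2 * c₂, c₂, 64 * h₀, 2 * h₀ * ρ, 4 * (W + 1)] ![g, g, θ, θ, c₁]
    (by intro i; fin_cases i <;> assumption)
  rw [← hWdef]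
  refine ⟨Polynomial.C c * Polynomial.X, fun e he => by simpa using mul_pos hc he,
    fun n hn => ⟨n * Y / θ * (Real.log (16 * ρ) + 1) + 2, ?_⟩⟩
  intro X H _ _ _ _ x fstar α₀ τ η₁ η₂ ε hτ h₁ h₂ hgap hproj hnorm hη₁ hη₁' hη₂ hη₂' hε hε4 hp
  exact sgd_estimationError hc₁ hc₂ hg hβ₀ hR hWdef hκ hθ hρ hY hh₀ hc (hcle 0) (hcle 1) (hcle 2)
    (hcle 3) (hcle 4) hn (by omega) (by omega) (by omega) x fstar α₀ τ η₁ η₂ ε hτ h₁ h₂ hgap hproj hnorm hη₁ hη₁' hη₂ hη₂' hε hε4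
    (by simpa using hp)
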